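/- Let $H$ be a real Hilbert space and let $A$ be a positive self-adjoint operator in $H$ with compact inverse. Let $0<\lambda_1\le\lambda_2\le\cdots$ be its eigenvalues, enumerated with multiplicity in non-decreasing order, and $\{e_k\}_{k\ge1}$ a corresponding orthonormal basis of $H$ of eigenvectors. Put $H_0^1:=D(A^{1/2})$ with norm $\|u\|_{H_0^1}=\|A^{1/2}u\|_H$. Let $P_N$ be the orthoprojector of $H_0^1$ onto $P_N(H_0^1)=\mathrm{span}\{e_1,\dots,e_N\}$ and $Q_N=\mathrm{Id}-P_N$. For $\theta\in\mathbb R$ let $L^2_\theta(\mathbb R_-,H_0^1)$, $\mathbb R_-=(-\infty,0]$, be the space with norm $\|v\|^2_{L^2_\theta}=\int_{-\infty}^0 e^{2\theta t}\|v(t)\|^2_{H_0^1}\,dt$. Solutions of $\partial_t v+Av=h$, $t\le 0$, are functions $v\in C(\mathbb R_-,H_0^1)$ satisfying the equation in the weak sense, i.e. $\frac{d}{dt}(v,\varphi)_H+(v,A\varphi)_H=(h,\varphi)_H$ (integrated in time) for all $\varphi\in D(A)$. Let $n\in\mathbb N^+$, $L_1,L_2\ge 0$, and let $N_1,\dots,N_n\in\mathbb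 N^+$ satisfy the spectral gap condition $$\lambda_{N_i+1}-\lambda_{N_i}>(i-1)\lambda_{N_{i-1}}+\lambda_{N_i+1}^{1/2}(i+1)L_1+(i+1)L_2,\qquad i=1,\dots,n,\qquad \lambda_{N_0}:=0 .$$ Put $$\gamma=\min_{1\le i\le n}\frac{\lambda_{N_i+1}-\lambda_{N_i}-(i-1)\lambda_{N_{i-1}}-\lambda_{N_i+1}^{1/2}(i+1)L_1-(i+1)L_2}{i+1},\qquad \theta_i=\lambda_{N_i}+\gamma+\lambda_{N_i+1}^{1/2}L_1+L_2 .$$ Then there is $\varepsilon_0\in(0,1]$ such that for every $\varepsilon\in(0,\varepsilon_0)$, for all $F_1\in C_b^{n+1}(H_0^1,H)$ and $F_2\in C_b^{n+1}(H_0^1,H_0^1)$ with Lipschitz constants $L_1$ and $L_2$, and for each $i=1,\dots,n$, the following holds. For every $p\in P_{N_i}(H_0^1)$ the problem $$\partial_t v+Av=F_1(v)+F_2(v),\qquad P_{N_i}v|_{t=0}=p,\qquad t\le 0,$$ has a unique solution $v=V(p,\cdot)$ in $L^2_{\theta_i}(\mathbb R_-,H_0^1)$; with $M_{N_i}(p):=Q_{N_i}V(p,0)$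 and $\mathcal M_{N_i}:=\{V(p,0):p\in P_{N_i}(H_0^1)\}$ (the manifold built by the Perron method): (i) The map $V$ is $C^{1,\varepsilon}$-smooth in $p$, both as a map $p\mapsto V(p,t)\in H_0^1$ for each fixed $t\le 0$ and as a map $p\mapsto V(p,\cdot)\in L^2_{(1+\varepsilon)\theta_i}(\mathbb R_-,H_0^1)$. Consequently $\mathcal M_{N_i}=\{p+M_{N_i}(p):p\in P_{N_i}(H_0^1)\}$ is $C^{1,\varepsilon}$-smooth, i.e. $M_{N_i}:P_{N_i}(H_0^1)\to Q_{N_i}(H_0^1)$ is a $C^{1,\varepsilon}$ map. (Here $C^{1,\varepsilon}$ means $C^1$ with globally $\varepsilon$-Hölder continuous Fréchet derivative.) (ii) For all $p,\xi\in P_{N_i}(H_0^1)$, $M_{N_i}'(p)\xi=Q_{N_i}V'_\xi(0)$, where $V'_\xi(t):=V'(p,t)\xi$ is the Fréchet derivative of $V(\cdot,t)$ at $p$ in the direction $\xi$, and $V'_\xi$ is the unique solution in $L^2_{\theta_i}(\mathbb R_-,H_0^1)$ of the equation of variations $$\partial_t V'_\xi+AV'_\xi-\bigl(F_1'(v)V'_\xi+F_2'(v)V'_\xi\bigr)=0,\qquad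 P_{N_i}V'_\xi|_{t=0}=\xi,\qquad t\le 0,\qquad v=V(p,\cdot).$$ (iii) There is a constant $C$ such that for all $p_1,p_2\in P_{N_i}(H_0^1)$, with $\xi=p_2-p_1$, $$\|V(p_2,\cdot)-V(p_1,\cdot)-V'(p_1,\cdot)\xi\|_{L^2_{(1+\varepsilon)\theta_i}(\mathbb R_-,H_0^1)}\le C\|p_2-p_1\|_{H_0^1}^{1+\varepsilon}.$$ -/

import Mathlib

open MeasureTheory Set
open scoped NNReal RealInnerProductSpace

noncomputable section

namespace InertialManifold

/-- A (possibly unbounded) positive self-adjoint operator `A : D(A) ⊆ H → H` with compact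
inverse on a real Hilbert space. -/
structure PosSelfAdjointOp (H : Type*) [NormedAddCommGroup H] [InnerProductSpace ℝ H]
    [CompleteSpace H] where
  /-- the operator together with its domain -/
  op : H →ₗ.[ℝ] H
  dense_domain : Dense (op.domain : Set H)
  selfAdjoint : IsSelfAdjoint op
  positive : ∀ x : op.domain, (x : H) ≠ 0 → 0 < ⟪op x, (x : H)⟫
  compact_inverse : ∃ K : H →L[ℝ] H, IsCompactOperator K ∧
    (∀ y : H, ∃ h : K y ∈ op.domain, op ⟨K y, h⟩ = y) ∧ ∀ x : op.domain, K (op x) = x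

/-- The eigenvalues of `A`, listed with multiplicity in non-decreasing order, and an orthonormal
basis of `H` formed by corresponding eigenvectors. The lists start at index `0`, that is,
`eigval k` is `λ_{k+1}` and `basis k` is `e_{k+1}`. -/
structure EigenSystem {H : Type*} [NormedAddCommGroup H] [InnerProductSpace ℝ H]
    [CompleteSpace H] (A : PosSelfAdjointOp H) where
  eigval : ℕ → ℝ
  basis : HilbertBasis ℕ ℝ H
  mono : Monotone eigval
  basis_mem : ∀ k, basis k ∈ A.op.domain
  op_basis : ∀ k, A.op ⟨basis k, basis_mem k⟩ = eigval k • basis k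

namespace EigenSystem

variable {H : Type*} [NormedAddCommGroup H] [InnerProductSpace ℝ H] [CompleteSpace H]
  {A : PosSelfAdjointOp H} (E : EigenSystem A)

/-- `λ_N` with the numbering `λ_1 ≤ λ_2 ≤ …`, and `λ_0 = 0`. -/
def lam : ℕ → ℝ
  | 0 => 0
  | k + 1 => E.eigval k

lemma eigval_pos (k : ℕ) : 0 < E.eigval k := by
  have hn : ‖E.basis k‖ = 1 := E.basis.orthonormal.1 k
  have h := A.positive ⟨E.basis k, E.basis_mem k⟩ (by
    intro h0
    simp only at h0
    rw [h0, norm_zero] at hn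
    exact zero_ne_one hn)
  rw [E.op_basis, real_inner_smul_left, real_inner_self_eq_norm_sq, hn] at h
  simpa using h

/-- The domain of `A^{1/2}`: all `u ∈ H` with `∑ λ_k ⟪e_k, u⟫² < ∞`. -/
def sqrtDomain : Submodule ℝ H where
  carrier := {u | Memℓp (fun k => √(E.eigval k) * E.basis.repr u k) 2}
  zero_mem' := by
    have h : (fun k => √(E.eigval k) * E.basis.repr (0 : H) k) = (0 : ℕ → ℝ) := by
      funext k; simp
    simp only [mem_ofPred_eq, h]
    exact zero_memℓp
  add_mem' := by
    intro u v hu hv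
    have h : (fun k => √(E.eigval k) * E.basis.repr (u + v) k) =
        (fun k => √(E.eigval k) * E.basis.repr u k) +
          fun k => √(E.eigval k) * E.basis.repr v k := by
      funext k; simp [mul_add]
    simp only [mem_ofPred_eq, h]
    exact hu.add hv
  smul_mem' := by
    intro c u hu
    have h : (fun k => √(E.eigval k) * E.basis.repr (c • u) k) =
        c • fun k => √(E.eigval k) * E.basis.repr u k := by
      funext k; simp; ring
    simp only [mem_ofPred_eq, h]
    exact hu.const_smul c

/-- The space `H_0^1 := D(A^{1/2})`; its norm is `‖A^{1/2} u‖` (see below), not the norm of `H`. -/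
def H1 : Type _ := E.sqrtDomain

instance : AddCommGroup E.H1 := inferInstanceAs (AddCommGroup E.sqrtDomain)

instance : Module ℝ E.H1 := inferInstanceAs (Module ℝ E.sqrtDomain)

/-- The embedding of `H_0^1` into `H`. -/
def incl : E.H1 →ₗ[ℝ] H := E.sqrtDomain.subtype

/-- The operator `A^{1/2} : H_0^1 → H`, `u ↦ ∑ λ_k^{1/2} ⟪e_k, u⟫ e_k`. -/
def sqrtOp : E.H1 →ₗ[ℝ] H where
  toFun u := E.basis.repr.symm ⟨fun k => √(E.eigval k) * E.basis.repr (E.incl u) k, u.2⟩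
  map_add' u v := by
    rw [← map_add]
    congr 1
    ext k
    simp only [map_add, lp.coeFn_add, Pi.add_apply, mul_add]
  map_smul' c u := by
    rw [RingHom.id_apply, ← map_smul]
    congr 1
    ext k
    simp
    ring

lemma repr_sqrtOp (u : E.H1) (k : ℕ) :
    E.basis.repr (E.sqrtOp u) k = √(E.eigval k) * E.basis.repr (E.incl u) k := by
  simp [sqrtOp]

lemma sqrtOp_eq_zero {u : E.H1} (h : E.sqrtOp u = 0) : u = 0 := by
  apply Subtype.ext
  change E.incl u = 0
  apply E.basis.repr.injective
  ext k
  have hk := E.repr_sqrtOp u k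
  rw [h] at hk
  have hs : √(E.eigval k) ≠ 0 := (Real.sqrt_pos.2 (E.eigval_pos k)).ne'
  have h0 : (0 : ℝ) = √(E.eigval k) * E.basis.repr (E.incl u) k := by simpa using hk
  simpa [hs] using h0.symm

/-- The inner product `⟪A^{1/2} u, A^{1/2} v⟫` of `H_0^1`. -/
@[reducible]
def h1Core : InnerProductSpace.Core ℝ E.H1 where
  inner u v := ⟪E.sqrtOp u, E.sqrtOp v⟫
  conj_inner_symm u v := by simp [real_inner_comm]
  re_inner_nonneg u := by simp
  add_left u v w := by simp [inner_add_left]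
  smul_left u v c := by simp [real_inner_smul_left]
  definite u h := E.sqrtOp_eq_zero (inner_self_eq_zero.1 h)

instance : NormedAddCommGroup E.H1 := E.h1Core.toNormedAddCommGroup

instance : InnerProductSpace ℝ E.H1 := InnerProductSpace.ofCore E.h1Core.toCore

lemma basis_mem_sqrtDomain (k : ℕ) : E.basis k ∈ E.sqrtDomain := by
  have h : (fun j => √(E.eigval j) * E.basis.repr (E.basis k) j) =
      ⇑(lp.single 2 k (√(E.eigval k)) : lp (fun _ : ℕ => ℝ) 2) := by
    funext j
    rw [E.basis.repr_self]
    by_cases hj : j = k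
    · subst hj; simp
    · simp [lp.single_apply, hj]
  change Memℓp (fun j => √(E.eigval j) * E.basis.repr (E.basis k) j) 2
  rw [h]
  exact lp.memℓp _

/-- The eigenvector `e_{k+1}` as an element of `H_0^1`. -/
def eigvec (k : ℕ) : E.H1 := (⟨E.basis k, E.basis_mem_sqrtDomain k⟩ : E.sqrtDomain)

/-- `P_N(H_0^1) = span {e_1, …, e_N}`, with the norm of `H_0^1`. The projectors `P_N` and `Q_N` are
the orthogonal projections of `H_0^1` onto this space and onto its orthogonal complement. -/
def PN (N : ℕ) : Submodule ℝ E.H1 := Submodule.span ℝ (range fun k : Fin N => E.eigvec k)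

instance (N : ℕ) : FiniteDimensional ℝ (E.PN N) :=
  FiniteDimensional.span_of_finite ℝ (finite_range _)

/-- `v ∈ C(ℝ₋, H_0^1)` is a solution of `∂_t v + A v = h` for `t ≤ 0`, in the weak sense: for every
`φ ∈ D(A)`, `d/dt ⟪v, φ⟫ + ⟪v, A φ⟫ = ⟪h, φ⟫`, integrated over `[s, t]`. -/
def IsSolution (h : ℝ → H) (v : ℝ → E.H1) : Prop :=
  ContinuousOn v (Iic 0) ∧
  ∀ (φ : A.op.domain) (s t : ℝ), s ≤ t → t ≤ 0 →
    ⟪E.incl (v t), (φ : H)⟫ - ⟪E.incl (v s), (φ : H)⟫ + ∫ τ in s..t, ⟪E.incl (v τ), A.op φ⟫ =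
      ∫ τ in s..t, ⟪h τ, (φ : H)⟫

end EigenSystem

/-- The measure `e^{2θt} dt` on `ℝ₋ = (-∞, 0]`, so that `L²_θ(ℝ₋, X)` is the space of `L²`
functions with values in `X` for this measure. -/
def expWeight (θ : ℝ) : Measure ℝ :=
  (volume.restrict (Iic 0)).withDensity fun t => ENNReal.ofReal (Real.exp (2 * θ * t))

/-- `F ∈ C_b^k(X, Y)`: `F` is `C^k`, and `F` and its derivatives up to order `k` are bounded. -/
def IsCb {X Y : Type*} [NormedAddCommGroup X] [NormedSpace ℝ X] [NormedAddCommGroup Y]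
    [NormedSpace ℝ Y] (k : ℕ) (F : X → Y) : Prop :=
  ContDiff ℝ k F ∧ ∀ j ≤ k, ∃ C : ℝ, ∀ x, ‖iteratedFDeriv ℝ j F x‖ ≤ C

/-- `f ∈ C^{1,α}(X, Y)`: `f` is `C^1` and its Fréchet derivative is Hölder continuous with
exponent `α` on `X`. -/
def IsC1Holder {X Y : Type*} [NormedAddCommGroup X] [NormedSpace ℝ X] [NormedAddCommGroup Y]
    [NormedSpace ℝ Y] (α : ℝ) (f : X → Y) : Prop :=
  ContDiff ℝ 1 f ∧ ∃ C : ℝ, ∀ x y, ‖fderiv ℝ f x - fderiv ℝ f y‖ ≤ C * ‖x - y‖ ^ α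

namespace EigenSystem

variable {H : Type*} [NormedAddCommGroup H] [InnerProductSpace ℝ H] [CompleteSpace H]
  {A : PosSelfAdjointOp H} (E : EigenSystem A)

/-- The quantity
`λ_{N_i+1} - λ_{N_i} - (i-1) λ_{N_{i-1}} - λ_{N_i+1}^{1/2} (i+1) L₁ - (i+1) L₂`. -/
def gapExcess (N : ℕ → ℕ) (L₁ L₂ : ℝ≥0) (i : ℕ) : ℝ :=
  E.lam (N i + 1) - E.lam (N i) - ((i : ℝ) - 1) * E.lam (N (i - 1))
    - √(E.lam (N i + 1)) * ((i : ℝ) + 1) * L₁ - ((i : ℝ) + 1) * L₂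

/-- `γ`, the minimum over `i = 1, …, n` of the gap excess divided by `i + 1`. -/
def gapGamma {n : ℕ} (hn : 1 ≤ n) (N : ℕ → ℕ) (L₁ L₂ : ℝ≥0) : ℝ :=
  (Finset.Icc 1 n).inf' (Finset.nonempty_Icc.2 hn)
    fun i => E.gapExcess N L₁ L₂ i / ((i : ℝ) + 1)

/-- `θ_i = λ_{N_i} + γ + λ_{N_i+1}^{1/2} L₁ + L₂`. -/
def theta {n : ℕ} (hn : 1 ≤ n) (N : ℕ → ℕ) (L₁ L₂ : ℝ≥0) (i : ℕ) : ℝ :=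
  E.lam (N i) + E.gapGamma hn N L₁ L₂ + √(E.lam (N i + 1)) * L₁ + L₂

variable (F₁ : E.H1 → H) (F₂ : E.H1 → E.H1) (θ : ℝ) (N : ℕ)

/-- `v ∈ L²_θ(ℝ₋, H_0^1)` solves the backward problem
`∂_t v + A v = F₁(v) + F₂(v)`, `P_N v|_{t=0} = p`, `t ≤ 0`. -/
def IsPerronSolution (p : E.PN N) (v : ℝ → E.H1) : Prop :=
  MemLp v 2 (expWeight θ) ∧
  E.IsSolution (fun t => F₁ (v t) + E.incl (F₂ (v t))) v ∧
  (E.PN N).orthogonalProjectionOnto (v 0) = p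

/-- `w ∈ L²_θ(ℝ₋, H_0^1)` solves the equation of variations along `v`:
`∂_t w + A w - (F₁'(v) w + F₂'(v) w) = 0`, `P_N w|_{t=0} = ξ`, `t ≤ 0`. -/
def IsVariationSolution (v : ℝ → E.H1) (ξ : E.PN N) (w : ℝ → E.H1) : Prop :=
  MemLp w 2 (expWeight θ) ∧
  E.IsSolution (fun t => fderiv ℝ F₁ (v t) (w t) + E.incl (fderiv ℝ F₂ (v t) (w t))) w ∧
  (E.PN N).orthogonalProjectionOnto (w 0) = ξ

/-- `V` is the map `(p, t) ↦ V(p, t)` of the Perron method: `V(p, ·)` is the unique solution on `ℝ₋`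
of the backward problem in `L²_θ(ℝ₋, H_0^1)`. -/
def IsPerronMap (V : E.PN N → ℝ → E.H1) : Prop :=
  ∀ p, E.IsPerronSolution F₁ F₂ θ N p (V p) ∧
    ∀ v, E.IsPerronSolution F₁ F₂ θ N p v → EqOn v (V p) (Iic 0)

variable {E N}

/-- `M_N : P_N(H_0^1) → Q_N(H_0^1)`, `M_N(p) = Q_N V(p, 0)`. -/
def graphMap (V : E.PN N → ℝ → E.H1) (p : E.PN N) : (E.PN N)ᗮ :=
  (E.PN N)ᗮ.orthogonalProjectionOnto (V p 0)

/-- `V'(p, t) ξ`, the Fréchet derivative of `q ↦ V(q, t)` at `p` applied to `ξ`. -/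
def derivV (V : E.PN N → ℝ → E.H1) (p ξ : E.PN N) (t : ℝ) : E.H1 :=
  fderiv ℝ (fun q => V q t) p ξ

end EigenSystem

end InertialManifold

end

open InertialManifold

/-!
In the eigenbasis of `A` the problem `∂ₜ v + A v = h`, `P_N v(0) = p` splits into scalar equations:
the modes with `λ_k ≤ λ_N` are solved backwards from `t = 0`, the higher ones forwards from
`t = -∞`. For `λ_N < θ < λ_{N+1}` the solution operator is bounded on `L²_θ`, with norm at most the
inverse of the distance `d` from `θ` to the spectrum (Schur's test in every mode), and it maps
`L²_θ(H)` to `L²_θ(H_0^1)` with an additional factor `λ_{N+1}^{1/2}`. Hence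
`λ_{N+1}^{1/2} L₁ + L₂ < d` makes the nonlinear problem a contraction, whose fixed point is `V`.

Differences `V(p₂, ·) - V(p₁, ·)`, the remainders `V(p₂, ·) - V(p₁, ·) - V'(p₁, ·)ξ` and the
differences `V'(p₂, ·)ξ - V'(p₁, ·)ξ` all solve the linearized problem. For the last two the forcing
is at most `C ‖y‖^ε ‖w‖` with `y` and `w` in `L²_θ` and `e^{θt} ‖y(t)‖` bounded, so it lies in
`L²_{(1+ε)θ}`, where the linearized problem is still uniquely solvable because the gap condition at
the weight `(1 + ε)θ` persists for small `ε`.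
-/

noncomputable section

open Filter
open scoped ENNReal Topology

namespace InertialManifold

/-! ### Exponentially weighted spaces -/

section Weighted

variable {X Y : Type*} [NormedAddCommGroup X] [NormedAddCommGroup Y] {θ θ' c : ℝ}

/-- The weighted size `e^{θt} ‖f(t)‖`, as an extended nonnegative real. -/
def expEnorm (θ : ℝ) (f : ℝ → X) (t : ℝ) : ℝ≥0∞ := ENNReal.ofReal (Real.exp (θ * t)) * ‖f t‖ₑ

lemma expEnorm_eq_ofReal (θ : ℝ) (f : ℝ → X) (t : ℝ) :
    expEnorm θ f t = ENNReal.ofReal (Real.exp (θ * t) * ‖f t‖) := by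
  rw [expEnorm, ← ofReal_norm, ← ENNReal.ofReal_mul (Real.exp_pos _).le]

lemma expEnorm_const_mul (θ c : ℝ) (f : ℝ → ℝ) (t : ℝ) :
    expEnorm θ (fun s => c * f s) t = ‖c‖ₑ * expEnorm θ f t := by
  rw [expEnorm, expEnorm, enorm_mul, mul_left_comm]

lemma aemeasurable_expEnorm {f : ℝ → X} (hf : AEStronglyMeasurable f (volume.restrict (Iic 0)))
    (θ : ℝ) : AEMeasurable (expEnorm θ f) (volume.restrict (Iic 0)) :=
  AEMeasurable.mul (by fun_prop) hf.enorm

lemma expWeight_absolutelyContinuous (θ : ℝ) : expWeight θ ≪ volume.restrict (Iic 0) :=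
  withDensity_absolutelyContinuous _ _

lemma absolutelyContinuous_expWeight (θ : ℝ) : volume.restrict (Iic 0) ≪ expWeight θ := by
  refine withDensity_absolutelyContinuous' (by fun_prop) (ae_of_all _ fun t => ?_)
  simpa using Real.exp_pos _

lemma aestronglyMeasurable_expWeight_iff {f : ℝ → X} :
    AEStronglyMeasurable f (expWeight θ) ↔ AEStronglyMeasurable f (volume.restrict (Iic 0)) :=
  ⟨fun h => h.mono_ac (absolutelyContinuous_expWeight θ),
    fun h => h.mono_ac (expWeight_absolutelyContinuous θ)⟩

lemma aestronglyMeasurable_expWeight_of_continuousOn {f : ℝ → X}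
    (hf : ContinuousOn f (Iic 0)) (θ : ℝ) : AEStronglyMeasurable f (expWeight θ) :=
  aestronglyMeasurable_expWeight_iff.2 (hf.aestronglyMeasurable measurableSet_Iic)

lemma ae_expWeight_of_forall {p : ℝ → Prop} (h : ∀ t ≤ 0, p t) : ∀ᵐ t ∂expWeight θ, p t :=
  (expWeight_absolutelyContinuous θ).ae_le ((ae_restrict_iff' measurableSet_Iic).2 (ae_of_all _ h))

lemma lintegral_expWeight (θ : ℝ) (f : ℝ → ℝ≥0∞) :
    ∫⁻ t, f t ∂expWeight θ = ∫⁻ t in Iic 0, ENNReal.ofReal (Real.exp (2 * θ * t)) * f t := by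
  rw [expWeight, lintegral_withDensity_eq_lintegral_mul_non_measurable _ (by fun_prop)
    (ae_of_all _ fun t => ENNReal.ofReal_lt_top)]
  rfl

lemma eLpNorm_expWeight_sq (θ : ℝ) (f : ℝ → X) :
    eLpNorm f 2 (expWeight θ) ^ 2 = ∫⁻ t in Iic 0, expEnorm θ f t ^ 2 := by
  have h2 : eLpNorm f 2 (expWeight θ) ^ 2 = ∫⁻ t, ‖f t‖ₑ ^ 2 ∂expWeight θ := by
    simpa using eLpNorm_nnreal_pow_eq_lintegral (μ := expWeight θ) (f := f) (p := 2) two_ne_zero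
  rw [h2, lintegral_expWeight]
  refine lintegral_congr fun t => ?_
  rw [expEnorm, mul_pow, ← ENNReal.ofReal_pow (Real.exp_pos _).le, ← Real.exp_nat_mul]
  congr 3
  push_cast; ring

lemma eLpNorm_expWeight_le {f : ℝ → X} {g : ℝ → Y} (hc : 0 ≤ c)
    (h : ∀ t ≤ 0, Real.exp (θ * t) * ‖f t‖ ≤ c * (Real.exp (θ' * t) * ‖g t‖)) :
    eLpNorm f 2 (expWeight θ) ≤ ENNReal.ofReal c * eLpNorm g 2 (expWeight θ') := by
  rw [← ENNReal.pow_le_pow_left_iff two_ne_zero, mul_pow, eLpNorm_expWeight_sq,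
    eLpNorm_expWeight_sq, ← lintegral_const_mul' _ _ (by finiteness)]
  refine setLIntegral_mono' measurableSet_Iic fun t ht => ?_
  rw [← mul_pow, expEnorm_eq_ofReal, expEnorm_eq_ofReal, ← ENNReal.ofReal_mul hc]
  exact pow_le_pow_left' (ENNReal.ofReal_le_ofReal (h t ht)) 2

lemma memLp_expWeight_of_le {f : ℝ → X} {g : ℝ → Y} (hf : AEStronglyMeasurable f (expWeight θ))
    (hg : MemLp g 2 (expWeight θ')) (hc : 0 ≤ c)
    (h : ∀ t ≤ 0, Real.exp (θ * t) * ‖f t‖ ≤ c * (Real.exp (θ' * t) * ‖g t‖)) :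
    MemLp f 2 (expWeight θ) :=
  ⟨hf, (eLpNorm_expWeight_le hc h).trans_lt (ENNReal.mul_lt_top ENNReal.ofReal_lt_top hg.2)⟩

lemma lpNorm_le_mul_of_eLpNorm_le {f : ℝ → X} {g : ℝ → Y} (hf : MemLp f 2 (expWeight θ))
    (hg : MemLp g 2 (expWeight θ')) (hc : 0 ≤ c)
    (h : eLpNorm f 2 (expWeight θ) ≤ ENNReal.ofReal c * eLpNorm g 2 (expWeight θ')) :
    lpNorm f 2 (expWeight θ) ≤ c * lpNorm g 2 (expWeight θ') := by
  rwa [← ofReal_lpNorm hf, ← ofReal_lpNorm hg, ← ENNReal.ofReal_mul hc,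
    ENNReal.ofReal_le_ofReal_iff (mul_nonneg hc lpNorm_nonneg)] at h

lemma lpNorm_expWeight_le {f : ℝ → X} {g : ℝ → Y} (hf : AEStronglyMeasurable f (expWeight θ))
    (hg : MemLp g 2 (expWeight θ')) (hc : 0 ≤ c)
    (h : ∀ t ≤ 0, Real.exp (θ * t) * ‖f t‖ ≤ c * (Real.exp (θ' * t) * ‖g t‖)) :
    lpNorm f 2 (expWeight θ) ≤ c * lpNorm g 2 (expWeight θ') :=
  lpNorm_le_mul_of_eLpNorm_le (memLp_expWeight_of_le hf hg hc h) hg hc (eLpNorm_expWeight_le hc h)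

lemma memLp_expWeight_mono (h : θ ≤ θ') {f : ℝ → X} (hf : MemLp f 2 (expWeight θ)) :
    MemLp f 2 (expWeight θ') := by
  refine memLp_expWeight_of_le
    (aestronglyMeasurable_expWeight_iff.2 (aestronglyMeasurable_expWeight_iff.1 hf.1)) hf
    zero_le_one fun t ht => ?_
  rw [one_mul]
  gcongr ?_ * _
  exact Real.exp_le_exp.2 (mul_le_mul_of_nonpos_right h ht)

lemma isFiniteMeasure_expWeight (hθ : 0 < θ) : IsFiniteMeasure (expWeight θ) := by
  refine ⟨?_⟩
  have h := lintegral_expWeight θ fun _ => 1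
  simp only [lintegral_one, mul_one] at h
  rw [h, ← ofReal_integral_eq_lintegral_ofReal
    (integrableOn_exp_mul_Iic (by positivity : 0 < 2 * θ) _)
    (ae_of_all _ fun _ => (Real.exp_pos _).le)]
  exact ENNReal.ofReal_lt_top

end Weighted

/-! ### The Schur test -/

section Schur

variable {α β : Type*} [MeasurableSpace α] [MeasurableSpace β] {μ : Measure α} {ν : Measure β}

lemma sq_lintegral_mul_le {f g : α → ℝ≥0∞} (hf : AEMeasurable f μ) (hg : AEMeasurable g μ) :
    (∫⁻ a, f a * g a ∂μ) ^ 2 ≤ (∫⁻ a, f a ^ 2 ∂μ) * ∫⁻ a, g a ^ 2 ∂μ := by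
  have h := ENNReal.lintegral_mul_le_Lp_mul_Lq μ Real.HolderConjugate.two_two hf hg
  calc (∫⁻ a, f a * g a ∂μ) ^ 2
      ≤ ((∫⁻ a, f a ^ (2 : ℝ) ∂μ) ^ (1 / 2 : ℝ) * (∫⁻ a, g a ^ (2 : ℝ) ∂μ) ^ (1 / 2 : ℝ)) ^ 2 := by
        gcongr; exact h
    _ = _ := by
        rw [mul_pow, ← ENNReal.rpow_natCast, ← ENNReal.rpow_natCast, ← ENNReal.rpow_mul,
          ← ENNReal.rpow_mul]
        simp

lemma sq_lintegral_mul_le_lintegral_mul_sq {k f : α → ℝ≥0∞} (hk : AEMeasurable k μ)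
    (hf : AEMeasurable f μ) :
    (∫⁻ a, k a * f a ∂μ) ^ 2 ≤ (∫⁻ a, k a ∂μ) * ∫⁻ a, k a * f a ^ 2 ∂μ := by
  have hf' : AEMeasurable f (μ.withDensity k) := hf.mono_ac (withDensity_absolutelyContinuous _ _)
  have h := sq_lintegral_mul_le (μ := μ.withDensity k) (f := 1) (by fun_prop) hf'
  simpa [lintegral_withDensity_eq_lintegral_mul₀ hk, hf, hf.pow_const] using h

theorem lintegral_sq_lintegral_mul_le [SFinite μ] [SFinite ν] {K : α → β → ℝ≥0∞} {a b : ℝ≥0∞}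
    {f : β → ℝ≥0∞} (hK : Measurable (Function.uncurry K)) (hf : AEMeasurable f ν) (ha : a ≠ ∞)
    (hrow : ∀ x, ∫⁻ y, K x y ∂ν ≤ a) (hcol : ∀ y, ∫⁻ x, K x y ∂μ ≤ b) :
    ∫⁻ x, (∫⁻ y, K x y * f y ∂ν) ^ 2 ∂μ ≤ a * b * ∫⁻ y, f y ^ 2 ∂ν :=
  calc ∫⁻ x, (∫⁻ y, K x y * f y ∂ν) ^ 2 ∂μ
      ≤ ∫⁻ x, a * ∫⁻ y, K x y * f y ^ 2 ∂ν ∂μ := by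
        refine lintegral_mono fun x =>
          (sq_lintegral_mul_le_lintegral_mul_sq hK.of_uncurry_left.aemeasurable hf).trans ?_
        gcongr
        exact hrow x
    _ = a * ∫⁻ y, (∫⁻ x, K x y ∂μ) * f y ^ 2 ∂ν := by
        rw [lintegral_const_mul' _ _ ha, lintegral_lintegral_swap
          (hK.aemeasurable.mul (hf.pow_const 2).comp_snd)]
        simp_rw [lintegral_mul_const _ hK.of_uncurry_right]
    _ ≤ a * ∫⁻ y, b * f y ^ 2 ∂ν := by
        gcongr with y
        exact hcol y
    _ ≤ a * b * ∫⁻ y, f y ^ 2 ∂ν := by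
        rw [lintegral_const_mul'' _ (hf.pow_const 2), mul_assoc]

end Schur

/-! ### Solutions of one mode `u' + l u = h` -/

section Mode

/-- The half-line of time differences on which Green's function of a mode lives: `b = true` stands
for a mode prescribed at time `0`, which is determined by the future of `h`, and `b = false` for a
mode without growth at `-∞`, which is determined by the past. -/
def greenSupport (b : Bool) : Set ℝ := if b then Iio 0 else Ici 0

/-- Green's function of `u' + l u = h` on the half-line `greenSupport b`. -/
def green (b : Bool) (l : ℝ) : ℝ → ℝ :=
  (greenSupport b).indicator fun x => (if b then -1 else 1) * Real.exp (-l * x)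

/-- The one-sided kernel of exponential decay at rate `δ` that dominates Green's function in
weighted spaces. -/
def expKernel (b : Bool) (δ : ℝ) : ℝ → ℝ≥0∞ :=
  (greenSupport b).indicator fun x => ENNReal.ofReal (Real.exp (-δ * |x|))

/-- The weight `θ` is separated from the eigenvalue `l` of a mode by at least `δ`, from above if
the mode is prescribed at time `0` and from below otherwise. -/
def ModeGap (b : Bool) (l θ δ : ℝ) : Prop := 0 < δ ∧ if b then l + δ ≤ θ else θ + δ ≤ l

/-- The solution of `u' + l u = h` on `ℝ₋` given by Green's function. -/
def modeSol (b : Bool) (l : ℝ) (h : ℝ → ℝ) (t : ℝ) : ℝ := ∫ s in Iic 0, green b l (t - s) * h s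

variable {b : Bool} {l θ δ : ℝ} {g h : ℝ → ℝ}

lemma measurableSet_greenSupport (b : Bool) : MeasurableSet (greenSupport b) := by
  cases b
  · exact measurableSet_Ici
  · exact measurableSet_Iio

lemma measurable_green (b : Bool) (l : ℝ) : Measurable (green b l) :=
  Measurable.indicator (by fun_prop) (measurableSet_greenSupport b)

lemma measurable_expKernel (b : Bool) (δ : ℝ) : Measurable (expKernel b δ) :=
  Measurable.indicator (by fun_prop) (measurableSet_greenSupport b)

lemma expKernel_sq (b : Bool) (δ x : ℝ) : expKernel b δ x ^ 2 = expKernel b (2 * δ) x := by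
  by_cases hx : x ∈ greenSupport b
  · rw [expKernel, expKernel, indicator_of_mem hx, indicator_of_mem hx,
      ← ENNReal.ofReal_pow (Real.exp_pos _).le, ← Real.exp_nat_mul]
    congr 2; push_cast; ring
  · simp [expKernel, hx]

lemma lintegral_expKernel (b : Bool) (hδ : 0 < δ) :
    ∫⁻ x, expKernel b δ x = ENNReal.ofReal (1 / δ) := by
  rw [expKernel, lintegral_indicator (measurableSet_greenSupport b)]
  cases b
  · change ∫⁻ x in Ici 0, _ = _
    rw [setLIntegral_congr_fun (g := fun x => ENNReal.ofReal (Real.exp (-δ * x)))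
      measurableSet_Ici fun x (hx : 0 ≤ x) => by simp only [abs_of_nonneg hx],
      setLIntegral_congr (by exact Ioi_ae_eq_Ici.symm), ← ofReal_integral_eq_lintegral_ofReal
      (integrableOn_exp_mul_Ioi (neg_neg_of_pos hδ) _) (ae_of_all _ fun _ => (Real.exp_pos _).le),
      integral_exp_mul_Ioi (neg_neg_of_pos hδ)]
    simp
  · change ∫⁻ x in Iio 0, _ = _
    rw [setLIntegral_congr_fun (g := fun x => ENNReal.ofReal (Real.exp (δ * x)))
      measurableSet_Iio fun x (hx : x < 0) => by simp only [abs_of_neg hx, neg_mul_neg],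
      setLIntegral_congr (by exact Iio_ae_eq_Iic), ← ofReal_integral_eq_lintegral_ofReal
      (integrableOn_exp_mul_Iic hδ _) (ae_of_all _ fun _ => (Real.exp_pos _).le),
      integral_exp_mul_Iic hδ]
    simp

lemma setLIntegral_expKernel_le (b : Bool) (hδ : 0 < δ) (s : Set ℝ) (t : ℝ) :
    ∫⁻ x in s, expKernel b δ (t - x) ≤ ENNReal.ofReal (1 / δ) :=
  (setLIntegral_le_lintegral _ _).trans
    ((lintegral_sub_left_eq_self _ t).trans (lintegral_expKernel b hδ)).le

lemma setLIntegral_expKernel_le' (b : Bool) (hδ : 0 < δ) (s : Set ℝ) (t : ℝ) :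
    ∫⁻ x in s, expKernel b δ (x - t) ≤ ENNReal.ofReal (1 / δ) :=
  (setLIntegral_le_lintegral _ _).trans
    ((lintegral_sub_right_eq_self _ t).trans (lintegral_expKernel b hδ)).le

lemma exp_mul_enorm_green_le (hl : ModeGap b l θ δ) (x : ℝ) :
    ENNReal.ofReal (Real.exp (θ * x)) * ‖green b l x‖ₑ ≤ expKernel b δ x := by
  obtain ⟨-, hl⟩ := hl
  by_cases hx : x ∈ greenSupport b
  · have hexp : θ * x - l * x ≤ -δ * |x| := by
      cases b
      · change 0 ≤ x at hx
        rw [abs_of_nonneg hx]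
        linear_combination mul_le_mul_of_nonneg_right (show θ + δ ≤ l from hl) hx
      · change x < 0 at hx
        rw [abs_of_neg hx]
        linear_combination mul_le_mul_of_nonpos_right (show l + δ ≤ θ from hl) hx.le
    have hsign : ‖(if b then -1 else 1 : ℝ)‖ₑ = 1 := by cases b <;> simp
    rw [green, expKernel, indicator_of_mem hx, indicator_of_mem hx, enorm_mul, hsign, one_mul,
      Real.enorm_eq_ofReal (Real.exp_pos _).le, ← ENNReal.ofReal_mul (Real.exp_pos _).le,
      ← Real.exp_add]
    gcongr
    linarith
  · simp [green, hx]

lemma exp_mul_lintegral_green_le (hl : ModeGap b l θ δ) (h : ℝ → ℝ) (t : ℝ) :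
    ENNReal.ofReal (Real.exp (θ * t)) * ∫⁻ s in Iic 0, ‖green b l (t - s) * h s‖ₑ ≤
      ∫⁻ s in Iic 0, expKernel b δ (t - s) * expEnorm θ h s := by
  rw [← lintegral_const_mul' _ _ (by finiteness)]
  refine lintegral_mono fun s => ?_
  have hexp : Real.exp (θ * t) = Real.exp (θ * (t - s)) * Real.exp (θ * s) := by
    rw [← Real.exp_add]; ring_nf
  rw [hexp, enorm_mul, ENNReal.ofReal_mul (Real.exp_pos _).le, mul_mul_mul_comm]
  exact mul_le_mul_left (exp_mul_enorm_green_le hl _) _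

lemma expEnorm_modeSol_le (hl : ModeGap b l θ δ) (h : ℝ → ℝ) (t : ℝ) :
    expEnorm θ (modeSol b l h) t ≤ ∫⁻ s in Iic 0, expKernel b δ (t - s) * expEnorm θ h s :=
  (mul_le_mul_right (enorm_integral_le_lintegral_enorm _) _).trans
    (exp_mul_lintegral_green_le hl h t)

lemma sq_lintegral_expKernel_mul_le (b : Bool) (hδ : 0 < δ) {f : ℝ → ℝ≥0∞}
    (hf : AEMeasurable f (volume.restrict (Iic 0))) (t : ℝ) :
    (∫⁻ s in Iic 0, expKernel b δ (t - s) * f s) ^ 2 ≤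
      ENNReal.ofReal (1 / (2 * δ)) * ∫⁻ s in Iic 0, f s ^ 2 := by
  have hm : Measurable fun s => expKernel b δ (t - s) :=
    (measurable_expKernel b δ).comp (by fun_prop)
  refine (sq_lintegral_mul_le hm.aemeasurable hf).trans ?_
  gcongr
  simp_rw [expKernel_sq]
  exact setLIntegral_expKernel_le b (by positivity) _ t

lemma expEnorm_modeSol_sq_le (hl : ModeGap b l θ δ)
    (hh : AEStronglyMeasurable h (expWeight θ)) (t : ℝ) :
    expEnorm θ (modeSol b l h) t ^ 2 ≤
      ENNReal.ofReal (1 / (2 * δ)) * eLpNorm h 2 (expWeight θ) ^ 2 := by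
  rw [eLpNorm_expWeight_sq]
  exact (pow_le_pow_left' (expEnorm_modeSol_le hl h t) 2).trans (sq_lintegral_expKernel_mul_le b
    hl.1 (aemeasurable_expEnorm (aestronglyMeasurable_expWeight_iff.1 hh) θ) t)

lemma eLpNorm_modeSol_le (hl : ModeGap b l θ δ) (hh : AEStronglyMeasurable h (expWeight θ)) :
    eLpNorm (modeSol b l h) 2 (expWeight θ) ≤
      ENNReal.ofReal (1 / δ) * eLpNorm h 2 (expWeight θ) := by
  rw [← ENNReal.pow_le_pow_left_iff two_ne_zero, mul_pow, eLpNorm_expWeight_sq,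
    eLpNorm_expWeight_sq]
  refine (lintegral_mono fun t => pow_le_pow_left' (expEnorm_modeSol_le hl h t) 2).trans ?_
  rw [sq (ENNReal.ofReal _)]
  exact lintegral_sq_lintegral_mul_le (K := fun t s => expKernel b δ (t - s))
    ((measurable_expKernel b δ).comp (by fun_prop))
    (aemeasurable_expEnorm (aestronglyMeasurable_expWeight_iff.1 hh) θ) ENNReal.ofReal_ne_top
    (setLIntegral_expKernel_le b hl.1 _) (setLIntegral_expKernel_le' b hl.1 _)

lemma integrable_green_mul (hl : ModeGap b l θ δ) (hh : MemLp h 2 (expWeight θ)) (t : ℝ) :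
    Integrable (fun s => green b l (t - s) * h s) (volume.restrict (Iic 0)) := by
  have hm := aestronglyMeasurable_expWeight_iff.1 hh.1
  have hg : Measurable fun s => green b l (t - s) := (measurable_green b l).comp (by fun_prop)
  refine ⟨hg.aestronglyMeasurable.mul hm, ?_⟩
  have hfin : ∫⁻ s in Iic 0, expKernel b δ (t - s) * expEnorm θ h s < ∞ := by
    have hsq := sq_lintegral_expKernel_mul_le b hl.1 (aemeasurable_expEnorm hm θ) t
    rw [← eLpNorm_expWeight_sq] at hsq
    exact (ENNReal.pow_lt_top_iff.1 (hsq.trans_lt (ENNReal.mul_lt_top ENNReal.ofReal_lt_top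
      (ENNReal.pow_lt_top hh.2)))).resolve_right two_ne_zero
  exact ENNReal.lt_top_of_mul_ne_top_right
    ((exp_mul_lintegral_green_le hl h t).trans_lt hfin).ne (by simpa using Real.exp_pos _)

lemma modeSol_add (hl : ModeGap b l θ δ) (hh : MemLp h 2 (expWeight θ))
    (hg : MemLp g 2 (expWeight θ)) (t : ℝ) :
    modeSol b l (fun s => h s + g s) t = modeSol b l h t + modeSol b l g t := by
  simp only [modeSol, mul_add]
  exact integral_add (integrable_green_mul hl hh t) (integrable_green_mul hl hg t)

lemma modeSol_const_mul (c : ℝ) (h : ℝ → ℝ) (t : ℝ) :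
    modeSol b l (fun s => c * h s) t = c * modeSol b l h t := by
  simp only [modeSol, mul_left_comm _ c, integral_const_mul]

lemma modeSol_congr (hg : h =ᵐ[volume.restrict (Iic 0)] g) : modeSol b l h = modeSol b l g :=
  funext fun _ => integral_congr_ae (hg.mono fun s hs => by simp only [hs])

lemma modeSol_true_zero (l : ℝ) (h : ℝ → ℝ) : modeSol true l h 0 = 0 := by
  rw [modeSol, setIntegral_eq_zero_of_forall_eq_zero]
  intro s hs
  simp [green, greenSupport, (mem_Iic.1 hs).not_gt]

lemma exp_mul_green_sub (b : Bool) (l : ℝ) {s t : ℝ} (hst : s ≤ t) (τ : ℝ) :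
    Real.exp (l * t) * green b l (t - τ) - Real.exp (l * s) * green b l (s - τ) =
      (Ioc s t).indicator (fun τ => Real.exp (l * τ)) τ := by
  have hexp : ∀ r, Real.exp (l * r) * Real.exp (-l * (r - τ)) = Real.exp (l * τ) := fun r => by
    rw [← Real.exp_add]; ring_nf
  rcases le_or_gt τ s with hτs | hsτ
  · cases b <;> simp [green, greenSupport, indicator, hτs, hτs.trans hst, hτs.not_gt,
      (hτs.trans hst).not_gt, hexp, -neg_mul]
  rcases le_or_gt τ t with hτt | htτ
  · cases b
    · simp [green, greenSupport, indicator, hsτ, hτt, hsτ.not_ge, hexp, -neg_mul]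
    · simp [green, greenSupport, indicator, hsτ, hτt, hτt.not_gt, hexp,
        mul_left_comm _ (-1 : ℝ), -neg_mul, neg_mul_eq_neg_mul]
  · cases b <;> simp [green, greenSupport, indicator, hsτ, htτ, hsτ.not_ge, htτ.not_ge, hexp,
      mul_left_comm _ (-1 : ℝ), -neg_mul]

lemma integrableOn_exp_mul (hl : ModeGap b l θ δ) (hh : MemLp h 2 (expWeight θ)) {s t : ℝ}
    (hst : s ≤ t) (ht : t ≤ 0) : IntegrableOn (fun τ => Real.exp (l * τ) * h τ) (Ioc s t) := by
  have hint := ((integrable_green_mul hl hh t).const_mul (Real.exp (l * t))).sub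
    ((integrable_green_mul hl hh s).const_mul (Real.exp (l * s)))
  refine (hint.mono_measure (Measure.restrict_mono (Ioc_subset_Iic_self.trans
    (Iic_subset_Iic.2 ht)) le_rfl)).congr
    ((ae_restrict_iff' measurableSet_Ioc).2 (ae_of_all _ fun τ hτ => ?_))
  simp only [Pi.sub_apply, ← mul_assoc]
  rw [← sub_mul, exp_mul_green_sub b l hst, indicator_of_mem hτ]

lemma exp_mul_modeSol_sub (hl : ModeGap b l θ δ) (hh : MemLp h 2 (expWeight θ)) {s t : ℝ}
    (hst : s ≤ t) (ht : t ≤ 0) :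
    Real.exp (l * t) * modeSol b l h t - Real.exp (l * s) * modeSol b l h s =
      ∫ τ in s..t, Real.exp (l * τ) * h τ := by
  rw [modeSol, modeSol, ← integral_const_mul, ← integral_const_mul, ← integral_sub
    ((integrable_green_mul hl hh t).const_mul _) ((integrable_green_mul hl hh s).const_mul _),
    intervalIntegral.integral_of_le hst, ← inter_eq_left.2 (Ioc_subset_Iic_self.trans
    (Iic_subset_Iic.2 ht)), inter_comm, ← setIntegral_indicator measurableSet_Ioc]
  refine integral_congr_ae (ae_of_all _ fun τ => ?_)
  simp only [← mul_assoc]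
  rw [← sub_mul, exp_mul_green_sub b l hst]
  simp [indicator]

lemma continuousOn_modeSol (hl : ModeGap b l θ δ) (hh : MemLp h 2 (expWeight θ)) :
    ContinuousOn (modeSol b l h) (Iic 0) := by
  set g : ℝ → ℝ := (Iic 0).indicator fun s => Real.exp (l * s) * h s with hg
  have hint : ∀ a c, IntervalIntegrable g volume a c := fun a c => by
    rw [intervalIntegrable_iff, hg, integrableOn_indicator_iff measurableSet_Iic]
    exact (integrableOn_exp_mul hl hh (min_le_right (min a c) 0) le_rfl).mono_set
      fun x hx => ⟨(min_le_left _ _).trans_lt hx.2.1, hx.1⟩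
  have hc : Continuous fun t => Real.exp (-l * t) * (modeSol b l h 0 - ∫ s in t..0, g s) := by
    have := intervalIntegral.continuous_primitive hint 0
    simp_rw [intervalIntegral.integral_symm 0]
    fun_prop
  refine hc.continuousOn.congr fun t ht => ?_
  have hgt : ∫ s in t..0, g s = ∫ s in t..0, Real.exp (l * s) * h s :=
    intervalIntegral.integral_congr fun s hs => by
      rw [uIcc_of_le ht] at hs
      simp [hg, hs.2]
  simp only
  rw [hgt, ← exp_mul_modeSol_sub hl hh ht le_rfl, mul_zero, Real.exp_zero, one_mul, sub_sub_cancel,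
    ← mul_assoc, ← Real.exp_add]
  simp

end Mode

section ScalarODE

lemma forall_sub_eq_integral_iff_hasDerivAt {X : Type*} [NormedAddCommGroup X] [NormedSpace ℝ X]
    [CompleteSpace X] {a : ℝ} {u g : ℝ → X} (hu : ContinuousOn u (Iic a))
    (hg : ContinuousOn g (Iic a)) :
    (∀ s t, s ≤ t → t ≤ a → u t - u s = ∫ τ in s..t, g τ) ↔ ∀ t < a, HasDerivAt u (g t) t := by
  have hint : ∀ {s t}, s ≤ t → t ≤ a → IntervalIntegrable g volume s t := fun hst ht =>
    (hg.mono (by rw [uIcc_of_le hst]; exact fun x hx => hx.2.trans ht)).intervalIntegrable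
  constructor
  · intro h t ht
    have hd : HasDerivAt (fun x => ∫ τ in x..a, g τ) (-g t) t :=
      intervalIntegral.integral_hasDerivAt_left (hint ht.le le_rfl)
        ((hg.mono Iio_subset_Iic_self).stronglyMeasurableAtFilter isOpen_Iio t ht)
        (hg.continuousAt (Iic_mem_nhds ht))
    refine ((hd.const_sub (u a)).congr_deriv (neg_neg _)).congr_of_eventuallyEq ?_
    filter_upwards [Iic_mem_nhds ht] with x hx
    rw [← h x a hx le_rfl, sub_sub_cancel]
  · intro h s t hst ht
    exact (intervalIntegral.integral_eq_sub_of_hasDerivAt_of_le hst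
      (hu.mono fun x hx => hx.2.trans ht) (fun x hx => h x (hx.2.trans_le ht)) (hint hst ht)).symm

lemma integrated_ode_iff_exp_mul_sub_eq {l a : ℝ} {u h : ℝ → ℝ} (hu : ContinuousOn u (Iic a))
    (hh : ContinuousOn h (Iic a)) :
    (∀ s t, s ≤ t → t ≤ a → u t - u s + l * ∫ τ in s..t, u τ = ∫ τ in s..t, h τ) ↔
      ∀ s t, s ≤ t → t ≤ a →
        Real.exp (l * t) * u t - Real.exp (l * s) * u s = ∫ τ in s..t, Real.exp (l * τ) * h τ := by
  have hderiv : ∀ t, HasDerivAt (fun t => Real.exp (l * t)) (Real.exp (l * t) * l) t := fun t => by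
    simpa using ((hasDerivAt_id t).const_mul l).exp
  have hleft : (∀ s t, s ≤ t → t ≤ a → u t - u s + l * ∫ τ in s..t, u τ = ∫ τ in s..t, h τ) ↔
      ∀ s t, s ≤ t → t ≤ a → u t - u s = ∫ τ in s..t, (h τ - l * u τ) := by
    refine forall₄_congr fun s t hst ht => ?_
    have hsub : uIcc s t ⊆ Iic a := by rw [uIcc_of_le hst]; exact fun x hx => hx.2.trans ht
    rw [intervalIntegral.integral_sub (hh.mono hsub).intervalIntegrable
      ((hu.mono hsub).intervalIntegrable.const_mul l), intervalIntegral.integral_const_mul,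
      eq_sub_iff_add_eq]
  rw [hleft, forall_sub_eq_integral_iff_hasDerivAt hu (by fun_prop),
    forall_sub_eq_integral_iff_hasDerivAt (by fun_prop) (by fun_prop)]
  refine forall₂_congr fun t _ =>
    ⟨fun hd => ((hderiv t).mul hd).congr_deriv (by ring), fun hd => ?_⟩
  have hinv : HasDerivAt (fun t => Real.exp (-l * t)) (Real.exp (-l * t) * -l) t := by
    simpa using ((hasDerivAt_id t).const_mul (-l)).exp
  have hcancel : ∀ t, Real.exp (-l * t) * Real.exp (l * t) = 1 := fun t => by
    rw [← Real.exp_add]; simp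
  refine ((hinv.mul hd).congr_deriv ?_).congr_of_eventuallyEq (.of_forall fun x => ?_)
  · linear_combination (h t - l * u t) * hcancel t
  · simp only [Pi.mul_apply, ← mul_assoc, hcancel, one_mul]

end ScalarODE

/-! ### Coordinates in a Hilbert basis -/

section Coordinates

variable {ι α X Y : Type*} [NormedAddCommGroup X] [InnerProductSpace ℝ X] [NormedAddCommGroup Y]
  [InnerProductSpace ℝ Y] (b : HilbertBasis ι ℝ X) (b' : HilbertBasis ι ℝ Y)

lemma continuous_repr_apply (k : ι) : Continuous fun x => b.repr x k := by
  simp_rw [b.repr_apply_apply]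
  fun_prop

lemma ext_repr {x y : X} (h : ∀ k, b.repr x k = b.repr y k) : x = y :=
  b.repr.injective (lp.ext (funext h))

lemma enorm_sq_eq_tsum_repr (x : X) : ‖x‖ₑ ^ 2 = ∑' k, ‖b.repr x k‖ₑ ^ 2 := by
  have h := lp.hasSum_norm (p := 2) (by norm_num) (b.repr x)
  simp only [ENNReal.toReal_ofNat, Real.rpow_ofNat, b.repr.norm_map] at h
  rw [← ofReal_norm, ← ENNReal.ofReal_pow (norm_nonneg _), ← h.tsum_eq,
    ENNReal.ofReal_tsum_of_nonneg (fun _ => by positivity) h.summable]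
  refine tsum_congr fun k => ?_
  rw [ENNReal.ofReal_pow (norm_nonneg _), ofReal_norm]

lemma norm_le_mul_norm_of_repr_le {x : X} {y : Y} {C : ℝ} (hC : 0 ≤ C)
    (h : ∀ k, |b.repr x k| ≤ C * |b'.repr y k|) : ‖x‖ ≤ C * ‖y‖ := by
  rw [← ENNReal.ofReal_le_ofReal_iff (by positivity), ENNReal.ofReal_mul hC, ofReal_norm,
    ofReal_norm, ← ENNReal.pow_le_pow_left_iff two_ne_zero, mul_pow, enorm_sq_eq_tsum_repr b,
    enorm_sq_eq_tsum_repr b', ← ENNReal.tsum_mul_left]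
  refine ENNReal.tsum_le_tsum fun k => ?_
  rw [← mul_pow, ← ofReal_norm, ← ofReal_norm, ← ENNReal.ofReal_mul hC]
  gcongr
  exact h k

lemma repr_tsum_smul {c : ι → ℝ} (hc : ∑' k, ‖c k‖ₑ ^ 2 ≠ ∞) (k : ι) :
    b.repr (∑' j, c j • b j) k = c k := by
  have hmem : Memℓp c 2 := memℓp_gen <| by
    simpa using ENNReal.summable_toReal hc
  rw [(b.hasSum_repr_symm ⟨c, hmem⟩).tsum_eq, LinearIsometryEquiv.apply_symm_apply]

lemma repr_sum_smul [DecidableEq ι] (s : Finset ι) (c : ι → ℝ) (k : ι) :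
    b.repr (∑ j ∈ s, c j • b j) k = if k ∈ s then c k else 0 := by
  rw [map_sum, lp.coeFn_sum, Finset.sum_apply]
  simp [b.repr_self, lp.single_apply, Pi.single_apply]

lemma enorm_sub_sum_repr_sq (x : X) (s : Finset ι) :
    ‖x - ∑ k ∈ s, b.repr x k • b k‖ₑ ^ 2 = ∑' k : {k // k ∉ s}, ‖b.repr x k‖ₑ ^ 2 := by
  classical
  rw [enorm_sq_eq_tsum_repr b]
  refine Eq.trans (tsum_congr fun k => ?_)
    (tsum_subtype {k | k ∉ s} fun k => ‖b.repr x k‖ₑ ^ 2).symm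
  rw [map_sub, lp.coeFn_sub, Pi.sub_apply, repr_sum_smul]
  by_cases hk : k ∈ s <;> simp [hk]

lemma continuousOn_of_repr [TopologicalSpace α] {x : α → X} {s : Set α} {u : ι → ℝ≥0∞}
    (hx : ∀ k, ContinuousOn (fun t => b.repr (x t) k) s) (hu : ∑' k, u k ≠ ∞)
    (h : ∀ t ∈ s, ∀ k, ‖b.repr (x t) k‖ₑ ^ 2 ≤ u k) : ContinuousOn x s := by
  refine TendstoUniformlyOn.continuousOn (p := atTop)
    (F := fun (S : Finset ι) t => ∑ k ∈ S, b.repr (x t) k • b k) ?_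
    (.of_forall fun S => continuousOn_finsetSum _ fun k _ => (hx k).smul continuousOn_const)
  refine EMetric.tendstoUniformlyOn_iff.2 fun ε hε => ?_
  filter_upwards [(ENNReal.tendsto_tsum_compl_atTop_zero hu).eventually_lt_const
    (ENNReal.pow_pos hε 2)] with S hS t ht
  have htail : ∑' k : {k // k ∉ S}, ‖b.repr (x t) k‖ₑ ^ 2 ≤ ∑' k : {k // k ∉ S}, u k :=
    ENNReal.tsum_le_tsum fun k => h t ht k
  rw [edist_eq_enorm_sub, ← ENNReal.pow_lt_pow_left_iff two_ne_zero, enorm_sub_sum_repr_sq]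
  exact htail.trans_lt hS

lemma eLpNorm_sq_eq_tsum_repr [Countable ι] {θ : ℝ} {f : ℝ → X}
    (hf : AEStronglyMeasurable f (expWeight θ)) :
    eLpNorm f 2 (expWeight θ) ^ 2 =
      ∑' k, eLpNorm (fun t => b.repr (f t) k) 2 (expWeight θ) ^ 2 := by
  simp only [eLpNorm_expWeight_sq, expEnorm, mul_pow, enorm_sq_eq_tsum_repr b,
    ← ENNReal.tsum_mul_left]
  refine lintegral_tsum fun k => ?_
  have hk := (continuous_repr_apply b k).comp_aestronglyMeasurable
    (aestronglyMeasurable_expWeight_iff.1 hf)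
  exact AEMeasurable.mul (by fun_prop) (hk.enorm.pow_const 2)

lemma eLpNorm_le_of_repr [Countable ι] {θ C : ℝ} {f : ℝ → X} {g : ℝ → Y}
    (hf : AEStronglyMeasurable f (expWeight θ)) (hg : AEStronglyMeasurable g (expWeight θ))
    (h : ∀ k, eLpNorm (fun t => b.repr (f t) k) 2 (expWeight θ) ≤
      ENNReal.ofReal C * eLpNorm (fun t => b'.repr (g t) k) 2 (expWeight θ)) :
    eLpNorm f 2 (expWeight θ) ≤ ENNReal.ofReal C * eLpNorm g 2 (expWeight θ) := by
  rw [← ENNReal.pow_le_pow_left_iff two_ne_zero, mul_pow, eLpNorm_sq_eq_tsum_repr b hf,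
    eLpNorm_sq_eq_tsum_repr b' hg, ← ENNReal.tsum_mul_left]
  refine ENNReal.tsum_le_tsum fun k => ?_
  rw [← mul_pow]
  gcongr
  exact h k

lemma memLp_repr {θ : ℝ} {f : ℝ → X} (hf : MemLp f 2 (expWeight θ)) (k : ι) :
    MemLp (fun t => b.repr (f t) k) 2 (expWeight θ) :=
  hf.of_le ((continuous_repr_apply b k).comp_aestronglyMeasurable hf.1) <| ae_of_all _ fun t =>
    (lp.norm_apply_le_norm two_ne_zero (b.repr (f t)) k).trans_eq (b.repr.norm_map _)

lemma tsum_mul_eLpNorm_repr_sq_ne_top [Countable ι] {θ : ℝ} {f : ℝ → X} {C : ℝ≥0∞} (hC : C ≠ ∞)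
    (hf : MemLp f 2 (expWeight θ)) :
    ∑' k, C * eLpNorm (fun t => b.repr (f t) k) 2 (expWeight θ) ^ 2 ≠ ∞ := by
  rw [ENNReal.tsum_mul_left, ← eLpNorm_sq_eq_tsum_repr b hf.1]
  have := hf.2.ne
  finiteness

end Coordinates

namespace EigenSystem

variable {H : Type*} [NormedAddCommGroup H] [InnerProductSpace ℝ H] [CompleteSpace H]
  {A : PosSelfAdjointOp H}

/-! ### The Hilbert space `H_0^1` -/

section H1

variable (E : EigenSystem A)

lemma sqrt_eigval_pos (k : ℕ) : 0 < √(E.eigval k) := Real.sqrt_pos.2 (E.eigval_pos k)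

lemma norm_sqrtOp (u : E.H1) : ‖E.sqrtOp u‖ = ‖u‖ := by
  have h : ⟪u, u⟫ = ⟪E.sqrtOp u, E.sqrtOp u⟫ := rfl
  rw [real_inner_self_eq_norm_sq, real_inner_self_eq_norm_sq] at h
  exact ((pow_left_inj₀ (norm_nonneg _) (norm_nonneg _) two_ne_zero).1 h).symm

lemma tsum_inv_sqrt_mul_repr_ne_top (y : H) :
    ∑' k, ‖(√(E.eigval k))⁻¹ * E.basis.repr y k‖ₑ ^ 2 ≠ ∞ := by
  have hle : ∑' k, ‖(√(E.eigval k))⁻¹ * E.basis.repr y k‖ₑ ^ 2 ≤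
      ‖(√(E.eigval 0))⁻¹‖ₑ ^ 2 * ‖y‖ₑ ^ 2 := by
    rw [enorm_sq_eq_tsum_repr E.basis y, ← ENNReal.tsum_mul_left]
    refine ENNReal.tsum_le_tsum fun k => ?_
    rw [← mul_pow, enorm_mul]
    gcongr
    have := E.sqrt_eigval_pos 0
    simp only [enorm_le_iff_norm_le, norm_inv, Real.norm_of_nonneg (Real.sqrt_nonneg _)]
    gcongr
    exact E.mono (Nat.zero_le k)
  exact ne_top_of_le_ne_top (by finiteness) hle

lemma sqrtOp_surjective : Function.Surjective E.sqrtOp := by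
  intro y
  set u : H := ∑' k, ((√(E.eigval k))⁻¹ * E.basis.repr y k) • E.basis k with hu
  have hrepr : ∀ k, √(E.eigval k) * E.basis.repr u k = E.basis.repr y k := fun k => by
    rw [hu, repr_tsum_smul E.basis (E.tsum_inv_sqrt_mul_repr_ne_top y),
      mul_inv_cancel_left₀ (E.sqrt_eigval_pos k).ne']
  have hmem : u ∈ E.sqrtDomain := by
    change Memℓp _ 2
    simp only [hrepr]
    exact lp.memℓp _
  exact ⟨(⟨u, hmem⟩ : E.sqrtDomain), ext_repr E.basis fun k => (E.repr_sqrtOp _ k).trans (hrepr k)⟩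

/-- `A^{1/2}` as an isometry of `H_0^1` onto `H`. -/
def sqrtIso : E.H1 ≃ₗᵢ[ℝ] H :=
  LinearIsometryEquiv.ofSurjective ⟨E.sqrtOp, E.norm_sqrtOp⟩ E.sqrtOp_surjective

instance : CompleteSpace E.H1 :=
  (completeSpace_congr (e := E.sqrtIso.toEquiv) E.sqrtIso.isometry.isUniformEmbedding).2
    inferInstance

/-- The orthonormal basis `λ_k^{-1/2} e_k` of `H_0^1`, indexed from `0` like `E.basis`. -/
def h1Basis : HilbertBasis ℕ ℝ E.H1 := .ofRepr (E.sqrtIso.trans E.basis.repr)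

lemma h1Basis_repr (u : E.H1) (k : ℕ) :
    E.h1Basis.repr u k = √(E.eigval k) * E.basis.repr (E.incl u) k :=
  E.repr_sqrtOp u k

lemma repr_incl (u : E.H1) (k : ℕ) :
    E.basis.repr (E.incl u) k = (√(E.eigval k))⁻¹ * E.h1Basis.repr u k := by
  rw [h1Basis_repr, inv_mul_cancel_left₀ (E.sqrt_eigval_pos k).ne']

lemma eigvec_eq_smul_h1Basis (k : ℕ) : E.eigvec k = √(E.eigval k) • E.h1Basis k := by
  refine ext_repr E.h1Basis fun j => ?_
  have hincl : E.incl (E.eigvec k) = E.basis k := rfl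
  rw [h1Basis_repr, hincl, map_smul, lp.coeFn_smul, Pi.smul_apply, E.basis.repr_self,
    E.h1Basis.repr_self]
  by_cases hj : j = k
  · subst hj; simp
  · simp [lp.single_apply, hj]

lemma norm_incl_le (u : E.H1) : ‖E.incl u‖ ≤ (√(E.eigval 0))⁻¹ * ‖u‖ := by
  refine norm_le_mul_norm_of_repr_le E.basis E.h1Basis (by positivity) fun k => ?_
  rw [repr_incl, abs_mul, abs_of_nonneg (by positivity)]
  have := E.sqrt_eigval_pos 0
  gcongr
  exact E.mono (Nat.zero_le k)

@[fun_prop]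
lemma continuous_incl : Continuous E.incl :=
  (E.incl.mkContinuous _ E.norm_incl_le).continuous

lemma memLp_incl {θ : ℝ} {g : ℝ → E.H1} (hg : MemLp g 2 (expWeight θ)) :
    MemLp (fun t => E.incl (g t)) 2 (expWeight θ) :=
  hg.of_le_mul (E.continuous_incl.comp_aestronglyMeasurable hg.1)
    (ae_of_all _ fun t => E.norm_incl_le (g t))

end H1

/-! ### The finite dimensional part -/

variable {E : EigenSystem A} {N : ℕ}

lemma h1Basis_mem_PN {k : ℕ} (hk : k < N) : E.h1Basis k ∈ E.PN N := by
  have h : E.eigvec k ∈ E.PN N := Submodule.subset_span ⟨⟨k, hk⟩, rfl⟩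
  rw [eigvec_eq_smul_h1Basis] at h
  exact (Submodule.smul_mem_iff _ (E.sqrt_eigval_pos k).ne').1 h

lemma mem_PN_orthogonal_iff {x : E.H1} :
    x ∈ (E.PN N)ᗮ ↔ ∀ k < N, E.h1Basis.repr x k = 0 := by
  simp_rw [E.h1Basis.repr_apply_apply]
  refine ⟨fun hx k hk => (Submodule.mem_orthogonal _ _).1 hx _ (h1Basis_mem_PN hk), fun hx => ?_⟩
  rw [← Submodule.span_singleton_le_iff_mem, ← Submodule.isOrtho_iff_le, Submodule.isOrtho_comm,
    PN, Submodule.isOrtho_span]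
  rintro _ ⟨k, rfl⟩ y rfl
  simp only
  rw [eigvec_eq_smul_h1Basis, real_inner_smul_left, hx k k.2, mul_zero]

lemma repr_PN_eq_zero (p : E.PN N) {k : ℕ} (hk : N ≤ k) : E.h1Basis.repr (p : E.H1) k = 0 := by
  have h : E.h1Basis k ∈ (E.PN N)ᗮ := mem_PN_orthogonal_iff.2 fun j hj => by
    simp [E.h1Basis.repr_self, lp.single_apply, (hj.trans_le hk).ne]
  rw [E.h1Basis.repr_apply_apply, real_inner_comm]
  exact (Submodule.mem_orthogonal _ _).1 h _ p.2

lemma orthogonalProjectionOnto_PN_eq_iff {x : E.H1} {p : E.PN N} :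
    (E.PN N).orthogonalProjectionOnto x = p ↔
      ∀ k < N, E.h1Basis.repr x k = E.h1Basis.repr (p : E.H1) k := by
  have hmem : x - (p : E.H1) ∈ (E.PN N)ᗮ ↔
      ∀ k < N, E.h1Basis.repr x k = E.h1Basis.repr (p : E.H1) k := by
    simp only [mem_PN_orthogonal_iff, map_sub, lp.coeFn_sub, Pi.sub_apply, sub_eq_zero]
  rw [← hmem]
  constructor
  · rintro rfl
    exact Submodule.sub_starProjection_mem_orthogonal x
  · intro h
    exact Subtype.ext (Submodule.eq_starProjection_of_mem_orthogonal p.2 h)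

variable {θ d : ℝ}

/-! ### The linear problem with a spectral gap -/

variable (E) in
/-- The weight `θ` lies between `λ_N` and `λ_{N+1}` and has distance at least `d > 0` to both. -/
structure SpectralGap (N : ℕ) (θ d : ℝ) : Prop where
  pos : 0 < d
  low : E.lam N + d ≤ θ
  high : θ + d ≤ E.lam (N + 1)

variable (E) in
/-- A lower bound for the distance from the weight to the `k`-th eigenvalue. It is constant for the
modes in `P_N` and grows linearly in the eigenvalue for the others, so that dividing by it gains one
power of `A`. -/
def modeWidth (N : ℕ) (d : ℝ) (k : ℕ) : ℝ := d * max 1 (E.eigval k / E.eigval N)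

lemma lam_nonneg (N : ℕ) : 0 ≤ E.lam N := by
  cases N with
  | zero => exact le_rfl
  | succ k => exact (E.eigval_pos k).le

lemma eigval_le_lam {k : ℕ} (hk : k < N) : E.eigval k ≤ E.lam N := by
  obtain ⟨m, rfl⟩ := Nat.exists_eq_add_one.2 (Nat.zero_lt_of_lt hk)
  exact E.mono (Nat.le_of_lt_succ hk)

section ModeWidth

variable (S : E.SpectralGap N θ d) (k : ℕ)
include S

lemma SpectralGap.modeWidth_pos : 0 < E.modeWidth N d k :=
  mul_pos S.pos (lt_max_of_lt_left one_pos)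

lemma SpectralGap.modeGap :
    ModeGap (decide (k < N)) (E.eigval k) θ (E.modeWidth N d k) := by
  refine ⟨S.modeWidth_pos k, ?_⟩
  have hN := E.eigval_pos N
  have hlow := S.low
  have hhigh : θ + d ≤ E.eigval N := S.high
  by_cases hk : k < N
  · simp only [hk, decide_true, if_true, modeWidth]
    rw [max_eq_left ((div_le_one hN).2 (E.mono hk.le)), mul_one]
    linarith [eigval_le_lam hk (E := E)]
  · have hratio : 1 ≤ E.eigval k / E.eigval N := (one_le_div hN).2 (E.mono (not_lt.1 hk))
    simp only [hk, decide_false, Bool.false_eq_true, if_false, modeWidth]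
    rw [max_eq_right hratio]
    calc θ + d * (E.eigval k / E.eigval N)
        ≤ (E.eigval N - d) * 1 + d * (E.eigval k / E.eigval N) := by linarith
      _ ≤ (E.eigval N - d) * (E.eigval k / E.eigval N) + d * (E.eigval k / E.eigval N) := by
          gcongr
          linarith [lam_nonneg (E := E) N, S.pos]
      _ = E.eigval k := by field_simp; ring

lemma SpectralGap.one_div_modeWidth_le : 1 / E.modeWidth N d k ≤ 1 / d :=
  one_div_le_one_div_of_le S.pos (le_mul_of_one_le_right S.pos.le (le_max_left _ _))

lemma SpectralGap.eigval_mul_one_div_modeWidth_le :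
    E.eigval k * (1 / E.modeWidth N d k) ≤ E.eigval N / d := by
  have hk := E.eigval_pos k
  have hN := E.eigval_pos N
  have hd := S.pos
  calc E.eigval k * (1 / E.modeWidth N d k)
      ≤ E.eigval k * (1 / (d * (E.eigval k / E.eigval N))) := by
        rw [modeWidth]
        gcongr
        exact le_max_right _ _
    _ = E.eigval N / d := by field_simp

lemma SpectralGap.sqrt_eigval_mul_one_div_modeWidth_le :
    √(E.eigval k) * (1 / E.modeWidth N d k) ≤ √(E.eigval N) / d := by
  have hk := E.eigval_pos k
  have hN := E.eigval_pos N
  have hd := S.pos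
  have hw := S.modeWidth_pos k
  rw [← sq_le_sq₀ (by positivity) (by positivity)]
  calc (√(E.eigval k) * (1 / E.modeWidth N d k)) ^ 2
      = E.eigval k * (1 / E.modeWidth N d k) * (1 / E.modeWidth N d k) := by
        rw [mul_pow, Real.sq_sqrt hk.le]; ring
    _ ≤ E.eigval N / d * (1 / d) := by
        gcongr ?_ * ?_
        · exact S.eigval_mul_one_div_modeWidth_le k
        · exact S.one_div_modeWidth_le k
    _ = (√(E.eigval N) / d) ^ 2 := by
        rw [div_pow, Real.sq_sqrt hN.le]; field_simp

end ModeWidth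

variable (E) in
/-- The `k`-th coordinate, with respect to `E.h1Basis`, of the solution of `∂_t v + A v = h` on
`ℝ₋` with `P_N v(0) = 0` whose part in `Q_N(H_0^1)` does not grow at `-∞`. -/
def mildCoord (N : ℕ) (h : ℝ → H) (k : ℕ) (t : ℝ) : ℝ :=
  √(E.eigval k) * modeSol (decide (k < N)) (E.eigval k) (fun s => E.basis.repr (h s) k) t

variable (E) in
/-- The solution of `∂_t v + A v = h` on `ℝ₋` with `P_N v(0) = 0` whose part in `Q_N(H_0^1)` does
not grow at `-∞`. -/
def mild (N : ℕ) (h : ℝ → H) (t : ℝ) : E.H1 := ∑' k, E.mildCoord N h k t • E.h1Basis k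

lemma mild_congr {f g : ℝ → H} (h : f =ᵐ[volume.restrict (Iic 0)] g) : E.mild N f = E.mild N g := by
  have hcoord (k : ℕ) : modeSol (decide (k < N)) (E.eigval k) (fun s => E.basis.repr (f s) k) =
      modeSol (decide (k < N)) (E.eigval k) fun s => E.basis.repr (g s) k :=
    modeSol_congr (h.mono fun s hs => by simp only [hs])
  ext t
  simp only [mild, mildCoord, hcoord]

namespace SpectralGap

variable (S : E.SpectralGap N θ d) {f h : ℝ → H} (hf : MemLp f 2 (expWeight θ))
  (hh : MemLp h 2 (expWeight θ))

include S hh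

lemma expEnorm_mildCoord_sq_le (k : ℕ) (t : ℝ) :
    expEnorm θ (E.mildCoord N h k) t ^ 2 ≤ ENNReal.ofReal (E.eigval N / (2 * d)) *
      eLpNorm (fun s => E.basis.repr (h s) k) 2 (expWeight θ) ^ 2 := by
  have hsqrt : ‖√(E.eigval k)‖ₑ ^ 2 = ENNReal.ofReal (E.eigval k) := by
    rw [Real.enorm_eq_ofReal (Real.sqrt_nonneg _), ← ENNReal.ofReal_pow (Real.sqrt_nonneg _),
      Real.sq_sqrt (E.eigval_pos k).le]
  have hconst : E.eigval k * (1 / (2 * E.modeWidth N d k)) ≤ E.eigval N / (2 * d) := by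
    calc _ = E.eigval k * (1 / E.modeWidth N d k) / 2 := by ring
      _ ≤ E.eigval N / d / 2 := by gcongr; exact S.eigval_mul_one_div_modeWidth_le k
      _ = E.eigval N / (2 * d) := by ring
  change expEnorm θ (fun s => √(E.eigval k) * modeSol _ _ _ s) t ^ 2 ≤ _
  rw [expEnorm_const_mul, mul_pow, hsqrt]
  refine (mul_le_mul_right (expEnorm_modeSol_sq_le (S.modeGap k)
    (memLp_repr E.basis hh k).1 t) _).trans ?_
  rw [← mul_assoc, ← ENNReal.ofReal_mul (E.eigval_pos k).le]
  gcongr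

lemma repr_mild (t : ℝ) (k : ℕ) : E.h1Basis.repr (E.mild N h t) k = E.mildCoord N h k t := by
  refine repr_tsum_smul E.h1Basis (c := fun k => E.mildCoord N h k t) ?_ k
  have hle := ENNReal.tsum_le_tsum fun k => S.expEnorm_mildCoord_sq_le hh k t
  simp only [expEnorm, mul_pow, ENNReal.tsum_mul_left] at hle
  refine (ENNReal.lt_top_of_mul_ne_top_right (ne_top_of_le_ne_top ?_ hle) ?_).ne
  · simpa only [ENNReal.tsum_mul_left] using
      tsum_mul_eLpNorm_repr_sq_ne_top E.basis ENNReal.ofReal_ne_top hh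
  · exact pow_ne_zero 2 (ENNReal.ofReal_pos.2 (Real.exp_pos _)).ne'

lemma expEnorm_mild_sq_le (t : ℝ) :
    expEnorm θ (E.mild N h) t ^ 2 ≤
      ENNReal.ofReal (E.eigval N / (2 * d)) * eLpNorm h 2 (expWeight θ) ^ 2 := by
  rw [expEnorm, mul_pow, enorm_sq_eq_tsum_repr E.h1Basis, eLpNorm_sq_eq_tsum_repr E.basis hh.1,
    ← ENNReal.tsum_mul_left, ← ENNReal.tsum_mul_left]
  refine ENNReal.tsum_le_tsum fun k => ?_
  rw [← mul_pow, S.repr_mild hh]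
  exact S.expEnorm_mildCoord_sq_le hh k t

lemma exp_mul_norm_mild_le (t : ℝ) :
    Real.exp (θ * t) * ‖E.mild N h t‖ ≤ √(E.eigval N / (2 * d)) * lpNorm h 2 (expWeight θ) := by
  have hsq := S.expEnorm_mild_sq_le hh t
  have hN := E.eigval_pos N
  have hd := S.pos
  have hlp := lpNorm_nonneg (f := h) (p := 2) (μ := expWeight θ)
  rw [expEnorm_eq_ofReal, ← ofReal_lpNorm hh, ← ENNReal.ofReal_pow (by positivity),
    ← ENNReal.ofReal_pow hlp, ← ENNReal.ofReal_mul (by positivity),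
    ENNReal.ofReal_le_ofReal_iff (by positivity)] at hsq
  rw [← sq_le_sq₀ (by positivity) (by positivity), mul_pow √_,
    Real.sq_sqrt (by positivity)]
  exact hsq

lemma continuousOn_mild : ContinuousOn (E.mild N h) (Iic 0) := by
  have hweighted : ContinuousOn (fun t => Real.exp (θ * t) • E.mild N h t) (Iic 0) := by
    refine continuousOn_of_repr E.h1Basis (fun k => ?_)
      (tsum_mul_eLpNorm_repr_sq_ne_top E.basis ENNReal.ofReal_ne_top hh)
      fun t _ k => le_trans (le_of_eq ?_) (S.expEnorm_mildCoord_sq_le hh k t)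
    · simp only [map_smul, lp.coeFn_smul, Pi.smul_apply, smul_eq_mul, S.repr_mild hh]
      exact ContinuousOn.mul (by fun_prop) (continuousOn_const.mul
        (continuousOn_modeSol (S.modeGap k) (memLp_repr E.basis hh k)))
    · rw [map_smul, lp.coeFn_smul, Pi.smul_apply, enorm_smul, S.repr_mild hh, expEnorm,
        Real.enorm_eq_ofReal (Real.exp_pos _).le]
  have hunweighted := ContinuousOn.smul
    (by fun_prop : ContinuousOn (fun t => Real.exp (-(θ * t))) (Iic 0)) hweighted
  refine hunweighted.congr fun t _ => ?_
  simp [smul_smul, ← Real.exp_add]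

lemma aestronglyMeasurable_mild : AEStronglyMeasurable (E.mild N h) (expWeight θ) :=
  aestronglyMeasurable_expWeight_of_continuousOn (S.continuousOn_mild hh) θ

lemma eLpNorm_repr_mild_le (k : ℕ) :
    eLpNorm (fun t => E.h1Basis.repr (E.mild N h t) k) 2 (expWeight θ) ≤
      ENNReal.ofReal (√(E.eigval k) * (1 / E.modeWidth N d k)) *
        eLpNorm (fun t => E.basis.repr (h t) k) 2 (expWeight θ) := by
  simp only [S.repr_mild hh]
  have hmode := eLpNorm_modeSol_le (S.modeGap k) (memLp_repr E.basis hh k).1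
  rw [ENNReal.ofReal_mul (Real.sqrt_nonneg _), mul_assoc]
  refine ((eLpNorm_const_smul √(E.eigval k) (modeSol (decide (k < N)) (E.eigval k)
    fun s => E.basis.repr (h s) k) 2 (expWeight θ)).trans_le ?_)
  rw [Real.enorm_eq_ofReal (Real.sqrt_nonneg _)]
  gcongr

lemma eLpNorm_mild_le :
    eLpNorm (E.mild N h) 2 (expWeight θ) ≤
      ENNReal.ofReal (√(E.eigval N) / d) * eLpNorm h 2 (expWeight θ) := by
  refine eLpNorm_le_of_repr E.h1Basis E.basis (S.aestronglyMeasurable_mild hh) hh.1 fun k =>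
    (S.eLpNorm_repr_mild_le hh k).trans ?_
  gcongr
  exact S.sqrt_eigval_mul_one_div_modeWidth_le k

lemma memLp_mild : MemLp (E.mild N h) 2 (expWeight θ) :=
  ⟨S.aestronglyMeasurable_mild hh,
    (S.eLpNorm_mild_le hh).trans_lt (ENNReal.mul_lt_top ENNReal.ofReal_lt_top hh.2)⟩

omit hh in
lemma eLpNorm_mild_incl_le {g : ℝ → E.H1} (hg : MemLp g 2 (expWeight θ)) :
    eLpNorm (E.mild N fun t => E.incl (g t)) 2 (expWeight θ) ≤
      ENNReal.ofReal (1 / d) * eLpNorm g 2 (expWeight θ) := by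
  have hg' := E.memLp_incl hg
  refine eLpNorm_le_of_repr E.h1Basis E.h1Basis (S.aestronglyMeasurable_mild hg') hg.1 fun k =>
    (S.eLpNorm_repr_mild_le hg' k).trans ?_
  have hscale := eLpNorm_const_smul √(E.eigval k) (fun t => E.basis.repr (E.incl (g t)) k) 2
    (expWeight θ)
  simp only [h1Basis_repr]
  change _ ≤ _ * eLpNorm (√(E.eigval k) • fun t => E.basis.repr (E.incl (g t)) k) 2 _
  rw [hscale, Real.enorm_eq_ofReal (Real.sqrt_nonneg _), ← mul_assoc,
    mul_comm (ENNReal.ofReal (1 / d)), ENNReal.ofReal_mul (Real.sqrt_nonneg _)]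
  gcongr ?_ * _
  exact mul_le_mul_right (ENNReal.ofReal_le_ofReal (S.one_div_modeWidth_le k)) _

include hf

lemma mild_add (t : ℝ) : E.mild N (fun s => f s + h s) t = E.mild N f t + E.mild N h t := by
  refine ext_repr E.h1Basis fun k => ?_
  have hfh : MemLp (fun s => f s + h s) 2 (expWeight θ) := hf.add hh
  rw [map_add, lp.coeFn_add, Pi.add_apply, S.repr_mild hfh, S.repr_mild hf, S.repr_mild hh,
    mildCoord, mildCoord, mildCoord, ← mul_add, ← modeSol_add (S.modeGap k)
    (memLp_repr E.basis hf k) (memLp_repr E.basis hh k)]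
  simp only [map_add, lp.coeFn_add, Pi.add_apply]

omit hh in
lemma mild_smul (c t : ℝ) : E.mild N (fun s => c • f s) t = c • E.mild N f t := by
  refine ext_repr E.h1Basis fun k => ?_
  have hcf : MemLp (fun s => c • f s) 2 (expWeight θ) := hf.const_smul c
  rw [map_smul, lp.coeFn_smul, Pi.smul_apply, S.repr_mild hcf, S.repr_mild hf,
    smul_eq_mul, mildCoord, mildCoord, mul_left_comm]
  simp only [map_smul, lp.coeFn_smul, Pi.smul_apply, smul_eq_mul, modeSol_const_mul]

lemma mild_sub (t : ℝ) : E.mild N (fun s => f s - h s) t = E.mild N f t - E.mild N h t := by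
  have hneg := S.mild_add hf (h := fun s => (-1 : ℝ) • h s) (hh.const_smul (-1 : ℝ)) t
  rw [S.mild_smul hh] at hneg
  simpa [sub_eq_add_neg] using hneg

end SpectralGap

end EigenSystem

/-- A bound `B` for `z` both in `L²_θ` and in the supremum of `e^{θt} ‖z(t)‖`. -/
structure WeightedBound {X : Type*} [NormedAddCommGroup X] (θ : ℝ) (z : ℝ → X) (B : ℝ) : Prop where
  memLp : MemLp z 2 (expWeight θ)
  lpNorm_le : lpNorm z 2 (expWeight θ) ≤ B
  exp_mul_norm_le : ∀ t ≤ 0, Real.exp (θ * t) * ‖z t‖ ≤ B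

namespace WeightedBound

variable {X : Type*} [NormedAddCommGroup X] {θ B B' : ℝ} {z : ℝ → X}

lemma mono (h : WeightedBound θ z B) (hB : B ≤ B') : WeightedBound θ z B' :=
  ⟨h.memLp, h.lpNorm_le.trans hB, fun t ht => (h.exp_mul_norm_le t ht).trans hB⟩

lemma eq_zero (h : WeightedBound θ z 0) {t : ℝ} (ht : t ≤ 0) : z t = 0 :=
  norm_le_zero_iff.1 (nonpos_of_mul_nonpos_right (h.exp_mul_norm_le t ht) (Real.exp_pos _))

end WeightedBound

namespace EigenSystem

variable {H : Type*} [NormedAddCommGroup H] [InnerProductSpace ℝ H] [CompleteSpace H]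
  {A : PosSelfAdjointOp H} {E : EigenSystem A} {N : ℕ} {θ d : ℝ}

/-- The solution `e^{-At} p` of the homogeneous equation, for `p ∈ P_N(H_0^1)`. -/
def free (p : E.PN N) (t : ℝ) : E.H1 :=
  ∑ k ∈ Finset.range N,
    (Real.exp (-E.eigval k * t) * E.h1Basis.repr (p : E.H1) k) • E.h1Basis k

lemma repr_free (p : E.PN N) (t : ℝ) (k : ℕ) :
    E.h1Basis.repr (free p t) k =
      Real.exp (-E.eigval k * t) * E.h1Basis.repr (p : E.H1) k := by
  rw [free, repr_sum_smul]
  split_ifs with hk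
  · rfl
  · rw [repr_PN_eq_zero p (by simpa using hk), mul_zero]

lemma free_add (p q : E.PN N) (t : ℝ) : free (p + q) t = free p t + free q t := by
  refine ext_repr E.h1Basis fun k => ?_
  simp only [map_add, lp.coeFn_add, Pi.add_apply, repr_free, Submodule.coe_add, mul_add]

lemma free_smul (c : ℝ) (p : E.PN N) (t : ℝ) : free (c • p) t = c • free p t := by
  refine ext_repr E.h1Basis fun k => ?_
  simp only [map_smul, lp.coeFn_smul, Pi.smul_apply, repr_free, Submodule.coe_smul, smul_eq_mul,
    mul_left_comm]

lemma free_sub (p q : E.PN N) (t : ℝ) : free (p - q) t = free p t - free q t := by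
  rw [sub_eq_add_neg p q, ← neg_one_smul ℝ q, free_add, free_smul, neg_one_smul, sub_eq_add_neg]

@[fun_prop]
lemma continuous_free (p : E.PN N) : Continuous (free p) := by
  unfold free
  fun_prop

namespace SpectralGap

variable (S : E.SpectralGap N θ d)
include S

lemma exp_mul_norm_free_le (p : E.PN N) {t : ℝ} (ht : t ≤ 0) :
    Real.exp (θ * t) * ‖free p t‖ ≤ Real.exp (d * t) * ‖p‖ := by
  have hfree : ‖free p t‖ ≤ Real.exp (-E.lam N * t) * ‖p‖ := by
    refine norm_le_mul_norm_of_repr_le E.h1Basis E.h1Basis (Real.exp_pos _).le fun k => ?_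
    rw [repr_free, abs_mul, abs_of_pos (Real.exp_pos _)]
    by_cases hk : k < N
    · gcongr ?_ * _
      exact Real.exp_le_exp.2 (mul_le_mul_of_nonpos_right (neg_le_neg (eigval_le_lam hk)) ht)
    · simp [repr_PN_eq_zero p (not_lt.1 hk)]
  calc Real.exp (θ * t) * ‖free p t‖
      ≤ Real.exp (θ * t) * (Real.exp (-E.lam N * t) * ‖p‖) := by gcongr
    _ = Real.exp ((θ - E.lam N) * t) * ‖p‖ := by
        rw [← mul_assoc, ← Real.exp_add]
        ring_nf
    _ ≤ Real.exp (d * t) * ‖p‖ := by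
        gcongr ?_ * _
        exact Real.exp_le_exp.2 (mul_le_mul_of_nonpos_right (by linarith [S.low]) ht)

lemma memLp_one : MemLp (fun _ => (1 : ℝ)) 2 (expWeight d) :=
  have := isFiniteMeasure_expWeight S.pos
  memLp_const 1

lemma memLp_free (p : E.PN N) : MemLp (free p) 2 (expWeight θ) := by
  refine memLp_expWeight_of_le (aestronglyMeasurable_expWeight_of_continuousOn
    (continuous_free p).continuousOn θ) S.memLp_one (norm_nonneg p) fun t ht => ?_
  simpa [mul_comm] using S.exp_mul_norm_free_le p ht

lemma lpNorm_free_le (p : E.PN N) :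
    lpNorm (free p) 2 (expWeight θ) ≤ lpNorm (fun _ => (1 : ℝ)) 2 (expWeight d) * ‖p‖ := by
  rw [mul_comm]
  refine lpNorm_expWeight_le (S.memLp_free p).1 S.memLp_one (norm_nonneg p) fun t ht => ?_
  simpa [mul_comm] using S.exp_mul_norm_free_le p ht

end SpectralGap

/-! ### The integral equation -/

/-- `v` is the solution in `L²_θ` of `∂_t v + A v = h`, `P_N v(0) = p`, in the form of the variation
of constants formula. -/
structure IntegralSol (θ : ℝ) (h : ℝ → H) (p : E.PN N) (v : ℝ → E.H1) : Prop where
  memLp_rhs : MemLp h 2 (expWeight θ)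
  eq : ∀ t ≤ 0, v t = E.mild N h t + free p t

section IntegralSol

variable {h g : ℝ → H} {p q : E.PN N} {v w : ℝ → E.H1}

lemma IntegralSol.mono (hv : IntegralSol θ h p v) {θ' : ℝ} (hθ : θ ≤ θ') : IntegralSol θ' h p v :=
  ⟨memLp_expWeight_mono hθ hv.memLp_rhs, hv.eq⟩

lemma IntegralSol.congr (hv : IntegralSol θ h p v) (hhg : EqOn h g (Iic 0)) :
    IntegralSol θ g p v := by
  have hae : h =ᵐ[volume.restrict (Iic 0)] g := ae_restrict_of_forall_mem measurableSet_Iic hhg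
  exact ⟨hv.memLp_rhs.ae_eq (ae_expWeight_of_forall hhg), mild_congr hae (E := E) ▸ hv.eq⟩

lemma IntegralSol.congr_sol (hv : IntegralSol θ h p v) (hvw : EqOn v w (Iic 0)) :
    IntegralSol θ h p w :=
  ⟨hv.memLp_rhs, fun t ht => (hvw ht).symm.trans (hv.eq t ht)⟩

namespace SpectralGap

variable (S : E.SpectralGap N θ d) (hv : IntegralSol θ h p v) (hw : IntegralSol θ g q w)
include S hv

lemma memLp_integralSol : MemLp v 2 (expWeight θ) :=
  ((S.memLp_mild hv.memLp_rhs).add (S.memLp_free p)).ae_eq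
    (ae_expWeight_of_forall fun t ht => (hv.eq t ht).symm)

lemma continuousOn_integralSol : ContinuousOn v (Iic 0) :=
  ((S.continuousOn_mild hv.memLp_rhs).add (continuous_free p).continuousOn).congr hv.eq

lemma integralSol_smul (c : ℝ) : IntegralSol θ (fun t => c • h t) (c • p) (fun t => c • v t) :=
  ⟨hv.memLp_rhs.const_smul c, fun t ht => by
    rw [hv.eq t ht, S.mild_smul hv.memLp_rhs, free_smul, smul_add]⟩

lemma exp_mul_norm_integralSol_le {t : ℝ} (ht : t ≤ 0) :
    Real.exp (θ * t) * ‖v t‖ ≤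
      √(E.eigval N / (2 * d)) * lpNorm h 2 (expWeight θ) + ‖p‖ := by
  have hfree : Real.exp (θ * t) * ‖free p t‖ ≤ ‖p‖ :=
    (S.exp_mul_norm_free_le p ht).trans <| mul_le_of_le_one_left (norm_nonneg p) <|
      Real.exp_le_one_iff.2 (mul_nonpos_of_nonneg_of_nonpos S.pos.le ht)
  calc Real.exp (θ * t) * ‖v t‖
      ≤ Real.exp (θ * t) * ‖E.mild N h t‖ + Real.exp (θ * t) * ‖free p t‖ := by
        rw [hv.eq t ht, ← mul_add]
        gcongr
        exact norm_add_le _ _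
    _ ≤ _ := add_le_add (S.exp_mul_norm_mild_le hv.memLp_rhs t) hfree

include hw

lemma integralSol_add : IntegralSol θ (fun t => h t + g t) (p + q) (fun t => v t + w t) :=
  ⟨hv.memLp_rhs.add hw.memLp_rhs, fun t ht => by
    rw [hv.eq t ht, hw.eq t ht, S.mild_add hv.memLp_rhs hw.memLp_rhs, free_add]; abel⟩

lemma integralSol_sub : IntegralSol θ (fun t => h t - g t) (p - q) (fun t => v t - w t) :=
  ⟨hv.memLp_rhs.sub hw.memLp_rhs, fun t ht => by
    rw [hv.eq t ht, hw.eq t ht, S.mild_sub hv.memLp_rhs hw.memLp_rhs, free_sub]; abel⟩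

end SpectralGap

end IntegralSol

/-! ### Stability of the integral equation -/

section Stability

variable {X : Type*} [NormedAddCommGroup X] {L L₁ L₂ : ℝ≥0} {f : ℝ → X} {h₁ r : ℝ → H}
  {h₂ z : ℝ → E.H1} {ξ : E.PN N}

lemma eLpNorm_expWeight_le_of_norm_le (hf : ∀ t ≤ 0, ‖f t‖ ≤ L * ‖z t‖) :
    eLpNorm f 2 (expWeight θ) ≤ ENNReal.ofReal L * eLpNorm z 2 (expWeight θ) := by
  refine eLpNorm_expWeight_le L.2 fun t ht => ?_
  rw [mul_left_comm]
  gcongr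
  exact hf t ht

namespace SpectralGap

variable (S : E.SpectralGap N θ d)
include S

lemma eLpNorm_mild_add_incl_le (hh₁ : MemLp h₁ 2 (expWeight θ)) (hh₂ : MemLp h₂ 2 (expWeight θ))
    (hz₁ : ∀ t ≤ 0, ‖h₁ t‖ ≤ L₁ * ‖z t‖) (hz₂ : ∀ t ≤ 0, ‖h₂ t‖ ≤ L₂ * ‖z t‖) :
    eLpNorm (E.mild N fun t => h₁ t + E.incl (h₂ t)) 2 (expWeight θ) ≤
      ENNReal.ofReal ((√(E.eigval N) * L₁ + L₂) / d) * eLpNorm z 2 (expWeight θ) := by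
  have hd := S.pos
  have hsplit : E.mild N (fun t => h₁ t + E.incl (h₂ t)) =
      E.mild N h₁ + E.mild N fun t => E.incl (h₂ t) :=
    funext fun t => S.mild_add hh₁ (E.memLp_incl hh₂) t
  calc eLpNorm (E.mild N fun t => h₁ t + E.incl (h₂ t)) 2 (expWeight θ)
      ≤ eLpNorm (E.mild N h₁) 2 (expWeight θ) +
          eLpNorm (E.mild N fun t => E.incl (h₂ t)) 2 (expWeight θ) := by
        rw [hsplit]
        exact eLpNorm_add_le (S.aestronglyMeasurable_mild hh₁)
          (S.aestronglyMeasurable_mild (E.memLp_incl hh₂)) one_le_two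
    _ ≤ ENNReal.ofReal (√(E.eigval N) / d) * eLpNorm h₁ 2 (expWeight θ) +
          ENNReal.ofReal (1 / d) * eLpNorm h₂ 2 (expWeight θ) :=
        add_le_add (S.eLpNorm_mild_le hh₁) (S.eLpNorm_mild_incl_le hh₂)
    _ ≤ ENNReal.ofReal (√(E.eigval N) / d) * (ENNReal.ofReal L₁ * eLpNorm z 2 (expWeight θ)) +
          ENNReal.ofReal (1 / d) * (ENNReal.ofReal L₂ * eLpNorm z 2 (expWeight θ)) := by
        gcongr
        · exact eLpNorm_expWeight_le_of_norm_le hz₁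
        · exact eLpNorm_expWeight_le_of_norm_le hz₂
    _ = _ := by
        rw [← mul_assoc, ← mul_assoc, ← add_mul, ← ENNReal.ofReal_mul (by positivity),
          ← ENNReal.ofReal_mul (by positivity),
          ← ENNReal.ofReal_add (by positivity) (by positivity)]
        congr 2
        ring

section

variable (hh₁ : MemLp h₁ 2 (expWeight θ)) (hh₂ : MemLp h₂ 2 (expWeight θ))
  (hr : MemLp r 2 (expWeight θ))
  (hz₁ : ∀ t ≤ 0, ‖h₁ t‖ ≤ L₁ * ‖z t‖) (hz₂ : ∀ t ≤ 0, ‖h₂ t‖ ≤ L₂ * ‖z t‖)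
  (hz : IntegralSol θ (fun s => h₁ s + E.incl (h₂ s) + r s) ξ z)
include hh₁ hh₂ hz₁ hz₂ hz

include hr in
lemma lpNorm_integralSol_le_add :
    lpNorm z 2 (expWeight θ) ≤
      (√(E.eigval N) * L₁ + L₂) / d * lpNorm z 2 (expWeight θ) +
        (√(E.eigval N) / d * lpNorm r 2 (expWeight θ) +
          lpNorm (fun _ => (1 : ℝ)) 2 (expWeight d) * ‖ξ‖) := by
  have hd := S.pos
  have hh : MemLp (fun s => h₁ s + E.incl (h₂ s)) 2 (expWeight θ) := hh₁.add (E.memLp_incl hh₂)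
  have hzmem := S.memLp_integralSol hz
  have hae : (E.mild N fun s => h₁ s + E.incl (h₂ s)) + (E.mild N r + free ξ) =ᵐ[expWeight θ] z :=
    ae_expWeight_of_forall fun t ht => by
      rw [hz.eq t ht, S.mild_add hh hr, add_assoc]; rfl
  have hsplit : lpNorm z 2 (expWeight θ) =
      lpNorm ((E.mild N fun s => h₁ s + E.incl (h₂ s)) + (E.mild N r + free ξ)) 2
        (expWeight θ) := by
    rw [← toReal_eLpNorm hzmem.1, ← toReal_eLpNorm (hzmem.1.congr hae.symm), eLpNorm_congr_ae hae]
  rw [hsplit]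
  refine (lpNorm_add_le (S.memLp_mild hh) one_le_two).trans (add_le_add ?_
    ((lpNorm_add_le (S.memLp_mild hr) one_le_two).trans (add_le_add ?_ (S.lpNorm_free_le ξ))))
  · rw [← hsplit]
    exact lpNorm_le_mul_of_eLpNorm_le (S.memLp_mild hh) hzmem (by positivity)
      (S.eLpNorm_mild_add_incl_le hh₁ hh₂ hz₁ hz₂)
  · exact lpNorm_le_mul_of_eLpNorm_le (S.memLp_mild hr) hr (by positivity) (S.eLpNorm_mild_le hr)

lemma lpNorm_rhs_le_add :
    lpNorm (fun s => h₁ s + E.incl (h₂ s) + r s) 2 (expWeight θ) ≤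
      (L₁ + (√(E.eigval 0))⁻¹ * L₂) * lpNorm z 2 (expWeight θ) + lpNorm r 2 (expWeight θ) := by
  have hzmem := S.memLp_integralSol hz
  have h₁_le : lpNorm h₁ 2 (expWeight θ) ≤ L₁ * lpNorm z 2 (expWeight θ) :=
    lpNorm_le_mul_of_eLpNorm_le hh₁ hzmem L₁.2 (eLpNorm_expWeight_le_of_norm_le hz₁)
  have h₂_le : lpNorm (fun s => E.incl (h₂ s)) 2 (expWeight θ) ≤
      (√(E.eigval 0))⁻¹ * L₂ * lpNorm z 2 (expWeight θ) := by
    refine lpNorm_expWeight_le (E.memLp_incl hh₂).1 hzmem (by positivity) fun t ht => ?_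
    rw [mul_left_comm, mul_assoc]
    gcongr
    exact (E.norm_incl_le _).trans (by gcongr; exact hz₂ t ht)
  have hadd := lpNorm_add_le (hh₁.add (E.memLp_incl hh₂)) (g := r) one_le_two
  have hadd' := lpNorm_add_le hh₁ (g := fun s => E.incl (h₂ s)) one_le_two
  exact hadd.trans (by linarith)

end

theorem exists_weightedBound (hL : √(E.eigval N) * L₁ + L₂ < d) :
    ∃ C : ℝ, 0 ≤ C ∧ ∀ {z h₂ : ℝ → E.H1} {h₁ r : ℝ → H} {ξ : E.PN N},
      MemLp h₁ 2 (expWeight θ) → MemLp h₂ 2 (expWeight θ) → MemLp r 2 (expWeight θ) →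
      (∀ t ≤ 0, ‖h₁ t‖ ≤ L₁ * ‖z t‖) → (∀ t ≤ 0, ‖h₂ t‖ ≤ L₂ * ‖z t‖) →
      IntegralSol θ (fun s => h₁ s + E.incl (h₂ s) + r s) ξ z →
      WeightedBound θ z (C * (lpNorm r 2 (expWeight θ) + ‖ξ‖)) := by
  have hd := S.pos
  set q : ℝ := (√(E.eigval N) * L₁ + L₂) / d
  have hq : 0 < 1 - q := sub_pos.2 ((div_lt_one hd).2 hL)
  set K : ℝ := lpNorm (fun _ => (1 : ℝ)) 2 (expWeight d)
  have hK : 0 ≤ K := lpNorm_nonneg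
  set a : ℝ := √(E.eigval N / (2 * d))
  set b : ℝ := L₁ + (√(E.eigval 0))⁻¹ * L₂
  set C₁ : ℝ := (√(E.eigval N) / d + K) / (1 - q)
  have hC₁ : 0 ≤ C₁ := by positivity
  refine ⟨C₁ + (a * (b * C₁ + 1) + 1), by positivity, fun {z h₂ h₁ r ξ} hh₁ hh₂ hr hz₁ hz₂ hz => ?_⟩
  set R := lpNorm r 2 (expWeight θ)
  have hR : 0 ≤ R := lpNorm_nonneg
  have hξ := norm_nonneg ξ
  have hzle : lpNorm z 2 (expWeight θ) ≤ C₁ * (R + ‖ξ‖) := by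
    have hz' := S.lpNorm_integralSol_le_add hh₁ hh₂ hr hz₁ hz₂ hz
    have hcross : 0 ≤ √(E.eigval N) / d * ‖ξ‖ + K * R := by positivity
    rw [div_mul_eq_mul_div, le_div_iff₀ hq]
    linarith
  refine ⟨S.memLp_integralSol hz, hzle.trans ?_, fun t ht => ?_⟩
  · gcongr
    exact le_add_of_nonneg_right (by positivity)
  calc Real.exp (θ * t) * ‖z t‖
      ≤ a * (b * lpNorm z 2 (expWeight θ) + R) + ‖ξ‖ :=
        (S.exp_mul_norm_integralSol_le hz ht).trans
          (by gcongr; exact S.lpNorm_rhs_le_add hh₁ hh₂ hz₁ hz₂ hz)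
    _ ≤ a * (b * (C₁ * (R + ‖ξ‖)) + (R + ‖ξ‖)) + (R + ‖ξ‖) := by gcongr <;> linarith
    _ = (a * (b * C₁ + 1) + 1) * (R + ‖ξ‖) := by ring
    _ ≤ _ := mul_le_mul_of_nonneg_right (le_add_of_nonneg_left hC₁) (by positivity)

end SpectralGap

end Stability

end EigenSystem

/-! ### Lipschitz fields -/

/-- The field `G(t, x)` acts on `L²_θ` by `v ↦ G(·, v(·))` and is Lipschitz in `x` for `t ≤ 0`. It
covers the nonlinearities of the equation and those of the equation of variations. -/
structure LipschitzField {X Y : Type*} [NormedAddCommGroup X] [NormedAddCommGroup Y] (θ : ℝ)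
    (L : ℝ≥0) (G : ℝ → X → Y) : Prop where
  aestronglyMeasurable : ∀ v : ℝ → X, AEStronglyMeasurable v (expWeight θ) →
    AEStronglyMeasurable (fun t => G t (v t)) (expWeight θ)
  lipschitz : ∀ t ≤ 0, LipschitzWith L (G t)
  memLp_zero : MemLp (fun t => G t 0) 2 (expWeight θ)

namespace LipschitzField

variable {X Y : Type*} [NormedAddCommGroup X] [NormedAddCommGroup Y] {θ : ℝ} {L : ℝ≥0}
  {G : ℝ → X → Y}

lemma norm_sub_le (hG : LipschitzField θ L G) {t : ℝ} (ht : t ≤ 0) (x y : X) :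
    ‖G t x - G t y‖ ≤ L * ‖x - y‖ := by
  simpa only [dist_eq_norm] using (hG.lipschitz t ht).dist_le_mul x y

lemma memLp_comp (hG : LipschitzField θ L G) {v : ℝ → X} (hv : MemLp v 2 (expWeight θ)) :
    MemLp (fun t => G t (v t)) 2 (expWeight θ) := by
  have hsub : MemLp (fun t => G t (v t) - G t 0) 2 (expWeight θ) := by
    refine hv.of_le_mul (c := L) ((hG.aestronglyMeasurable v hv.1).sub hG.memLp_zero.1)
      (ae_expWeight_of_forall fun t ht => ?_)
    simpa only [sub_zero] using hG.norm_sub_le ht (v t) 0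
  exact (hsub.add hG.memLp_zero).ae_eq (ae_of_all _ fun t => sub_add_cancel _ _)

lemma of_lipschitzWith (hθ : 0 < θ) {F : X → Y} (hF : LipschitzWith L F) :
    LipschitzField θ L fun _ => F :=
  have := isFiniteMeasure_expWeight hθ
  ⟨fun _ hv => hF.continuous.comp_aestronglyMeasurable hv, fun _ _ => hF, memLp_const _⟩

lemma of_clm [NormedSpace ℝ X] [NormedSpace ℝ Y] {T : ℝ → X →L[ℝ] Y}
    (hT : ContinuousOn T (Iic 0)) (hL : ∀ t, ‖T t‖₊ ≤ L) : LipschitzField θ L fun t x => T t x where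
  aestronglyMeasurable v hv :=
    isBoundedBilinearMap_apply.continuous.comp_aestronglyMeasurable
      ((aestronglyMeasurable_expWeight_of_continuousOn hT θ).prodMk hv)
  lipschitz t _ := (T t).lipschitz.weaken (hL t)
  memLp_zero := by simp only [map_zero, MemLp.zero']

end LipschitzField

namespace EigenSystem

variable {H : Type*} [NormedAddCommGroup H] [InnerProductSpace ℝ H] [CompleteSpace H]
  {A : PosSelfAdjointOp H} {E : EigenSystem A} {N : ℕ} {θ d : ℝ} {L₁ L₂ : ℝ≥0}
  {G₁ : ℝ → E.H1 → H} {G₂ : ℝ → E.H1 → E.H1}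

/-- The right hand side `G₁(t, v(t)) + G₂(t, v(t))` of the equation, as a function with values in
`H`. -/
def source (G₁ : ℝ → E.H1 → H) (G₂ : ℝ → E.H1 → E.H1) (v : ℝ → E.H1) (t : ℝ) : H :=
  G₁ t (v t) + E.incl (G₂ t (v t))

lemma memLp_source (hG₁ : LipschitzField θ L₁ G₁) (hG₂ : LipschitzField θ L₂ G₂) {v : ℝ → E.H1}
    (hv : MemLp v 2 (expWeight θ)) : MemLp (source G₁ G₂ v) 2 (expWeight θ) :=
  (hG₁.memLp_comp hv).add (E.memLp_incl (hG₂.memLp_comp hv))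

namespace SpectralGap

variable (S : E.SpectralGap N θ d) (hG₁ : LipschitzField θ L₁ G₁) (hG₂ : LipschitzField θ L₂ G₂)
include S hG₁ hG₂

lemma eLpNorm_mild_source_sub_le {v w : ℝ → E.H1} (hv : MemLp v 2 (expWeight θ))
    (hw : MemLp w 2 (expWeight θ)) :
    eLpNorm (E.mild N (source G₁ G₂ v) - E.mild N (source G₁ G₂ w)) 2 (expWeight θ) ≤
      ENNReal.ofReal ((√(E.eigval N) * L₁ + L₂) / d) * eLpNorm (v - w) 2 (expWeight θ) := by
  have hsub : E.mild N (source G₁ G₂ v) - E.mild N (source G₁ G₂ w) =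
      E.mild N fun t => (G₁ t (v t) - G₁ t (w t)) + E.incl (G₂ t (v t) - G₂ t (w t)) := by
    ext1 t
    rw [Pi.sub_apply, ← S.mild_sub (memLp_source hG₁ hG₂ hv) (memLp_source hG₁ hG₂ hw)]
    simp only [source, map_sub, add_sub_add_comm]
  rw [hsub]
  exact S.eLpNorm_mild_add_incl_le ((hG₁.memLp_comp hv).sub (hG₁.memLp_comp hw))
    ((hG₂.memLp_comp hv).sub (hG₂.memLp_comp hw)) (fun t ht => hG₁.norm_sub_le ht _ _)
    fun t ht => hG₂.norm_sub_le ht _ _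

theorem exists_integralSol (hL : √(E.eigval N) * L₁ + L₂ < d) (p : E.PN N) :
    ∃ v : ℝ → E.H1, IntegralSol θ (source G₁ G₂ v) p v := by
  have hmem {v : ℝ → E.H1} (hv : MemLp v 2 (expWeight θ)) :
      MemLp (E.mild N (source G₁ G₂ v) + free p) 2 (expWeight θ) :=
    (S.memLp_mild (memLp_source hG₁ hG₂ hv)).add (S.memLp_free p)
  let Φ (v : Lp E.H1 2 (expWeight θ)) : Lp E.H1 2 (expWeight θ) := (hmem (Lp.memLp v)).toLp _
  have hΦ : ContractingWith (Real.toNNReal ((√(E.eigval N) * L₁ + L₂) / d)) Φ := by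
    refine ⟨Real.toNNReal_lt_one.2 ((div_lt_one S.pos).2 hL), fun v w => ?_⟩
    rw [Lp.edist_toLp_toLp, Lp.edist_def, add_sub_add_right_eq_sub]
    exact S.eLpNorm_mild_source_sub_le hG₁ hG₂ (Lp.memLp v) (Lp.memLp w)
  obtain ⟨w, hw⟩ : ∃ w, Φ w = w := ⟨_, hΦ.fixedPoint_isFixedPt⟩
  -- The fixed point is only an equivalence class; its image under the integral operator is the
  -- representative that satisfies the equation at every time.
  set v := E.mild N (source G₁ G₂ w) + free p with hv
  have hvw : v =ᵐ[expWeight θ] w := by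
    have hcoe := MemLp.coeFn_toLp (hmem (Lp.memLp w))
    exact hcoe.symm.trans (.of_eq (congrArg (fun f : Lp E.H1 2 (expWeight θ) => ⇑f) hw))
  have hsource : source G₁ G₂ v =ᵐ[volume.restrict (Iic 0)] source G₁ G₂ w :=
    ((absolutelyContinuous_expWeight θ).ae_eq hvw).mono fun t ht => by simp only [source, ht]
  refine ⟨v, memLp_source hG₁ hG₂ (hmem (Lp.memLp w)), fun t _ => ?_⟩
  rw [mild_congr hsource, hv, Pi.add_apply]

end SpectralGap

end EigenSystem

/-! ### Weak solutions -/

section WeakSolution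

variable {H : Type*} [NormedAddCommGroup H] [InnerProductSpace ℝ H]

lemma intervalIntegral_inner_left [CompleteSpace H] {f : ℝ → H} {s t : ℝ}
    (hf : IntervalIntegrable f volume s t) (x : H) :
    ∫ τ in s..t, ⟪f τ, x⟫ = ⟪∫ τ in s..t, f τ, x⟫ := by
  simpa only [innerSL_apply_apply, real_inner_comm] using
    (innerSL ℝ x).intervalIntegral_comp_comm hf

lemma inner_eq_of_forall_inner_eq {ι : Type*} (b : HilbertBasis ι ℝ H) {x y u z : H}
    (h : ∀ k, ⟪x, b k⟫ * ⟪b k, u⟫ = ⟪y, b k⟫ * ⟪b k, z⟫) : ⟪x, u⟫ = ⟪y, z⟫ :=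
  (b.hasSum_inner_mul_inner x u).unique (by simpa only [h] using b.hasSum_inner_mul_inner y z)

end WeakSolution

namespace EigenSystem

variable {H : Type*} [NormedAddCommGroup H] [InnerProductSpace ℝ H] [CompleteSpace H]
  {A : PosSelfAdjointOp H} {E : EigenSystem A} {N : ℕ} {θ d : ℝ} {h : ℝ → H} {v w : ℝ → E.H1}

lemma inner_basis_op (φ : A.op.domain) (k : ℕ) :
    ⟪E.basis k, A.op φ⟫ = E.eigval k * ⟪E.basis k, (φ : H)⟫ := by
  have hsymm := LinearPMap.adjoint_isFormalAdjoint A.dense_domain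
  rw [LinearPMap.isSelfAdjoint_def.1 A.selfAdjoint] at hsymm
  rw [← real_inner_smul_left, ← E.op_basis]
  exact (hsymm ⟨E.basis k, E.basis_mem k⟩ φ).symm

lemma repr_basis_eq_inner (x : H) (k : ℕ) : E.basis.repr x k = ⟪x, E.basis k⟫ := by
  rw [E.basis.repr_apply_apply, real_inner_comm]

lemma IsSolution.integrated_modes (hv : E.IsSolution h v) (k : ℕ) {s t : ℝ} (hst : s ≤ t)
    (ht : t ≤ 0) :
    E.basis.repr (E.incl (v t)) k - E.basis.repr (E.incl (v s)) k +
        E.eigval k * ∫ τ in s..t, E.basis.repr (E.incl (v τ)) k =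
      ∫ τ in s..t, E.basis.repr (h τ) k := by
  have hk := hv.2 ⟨E.basis k, E.basis_mem k⟩ s t hst ht
  rw [E.op_basis] at hk
  simpa only [real_inner_smul_right, intervalIntegral.integral_const_mul, repr_basis_eq_inner]
    using hk

lemma isSolution_of_integrated_modes (hh : ContinuousOn h (Iic 0)) (hv : ContinuousOn v (Iic 0))
    (hmode : ∀ k s t, s ≤ t → t ≤ 0 →
      E.basis.repr (E.incl (v t)) k - E.basis.repr (E.incl (v s)) k +
          E.eigval k * ∫ τ in s..t, E.basis.repr (E.incl (v τ)) k =
        ∫ τ in s..t, E.basis.repr (h τ) k) :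
    E.IsSolution h v := by
  refine ⟨hv, fun φ s t hst ht => ?_⟩
  have hsub : uIcc s t ⊆ Iic 0 := by rw [uIcc_of_le hst]; exact fun x hx => hx.2.trans ht
  have hh_int : IntervalIntegrable h volume s t := (hh.mono hsub).intervalIntegrable
  have hv_int : IntervalIntegrable (fun τ => E.incl (v τ)) volume s t :=
    ((E.continuous_incl.comp_continuousOn hv).mono hsub).intervalIntegrable
  have hinner : ⟪(∫ τ in s..t, h τ) - (E.incl (v t) - E.incl (v s)), (φ : H)⟫ =
      ⟪∫ τ in s..t, E.incl (v τ), A.op φ⟫ := by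
    refine inner_eq_of_forall_inner_eq E.basis fun k => ?_
    have hk := hmode k s t hst ht
    simp only [repr_basis_eq_inner] at hk
    rw [intervalIntegral_inner_left hv_int, intervalIntegral_inner_left hh_int] at hk
    rw [inner_basis_op, inner_sub_left, inner_sub_left, ← hk]
    ring
  rw [intervalIntegral_inner_left hv_int, intervalIntegral_inner_left hh_int, ← hinner,
    inner_sub_left, inner_sub_left]
  ring

lemma continuousOn_repr_incl (hv : ContinuousOn v (Iic 0)) (k : ℕ) :
    ContinuousOn (fun t => E.basis.repr (E.incl (v t)) k) (Iic 0) :=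
  ((continuous_repr_apply E.basis k).comp E.continuous_incl).comp_continuousOn hv

theorem isSolution_iff_exp_mul_sub_eq (hh : ContinuousOn h (Iic 0))
    (hv : ContinuousOn v (Iic 0)) :
    E.IsSolution h v ↔ ∀ k s t, s ≤ t → t ≤ 0 →
      Real.exp (E.eigval k * t) * E.basis.repr (E.incl (v t)) k -
          Real.exp (E.eigval k * s) * E.basis.repr (E.incl (v s)) k =
        ∫ τ in s..t, Real.exp (E.eigval k * τ) * E.basis.repr (h τ) k := by
  have hmode (k : ℕ) := integrated_ode_iff_exp_mul_sub_eq (l := E.eigval k)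
    (continuousOn_repr_incl hv k) ((continuous_repr_apply E.basis k).comp_continuousOn hh)
  exact ⟨fun hsol k => (hmode k).1 fun _ _ => hsol.integrated_modes k,
    fun hexp => isSolution_of_integrated_modes hh hv fun k => (hmode k).2 (hexp k)⟩

lemma IsSolution.exists_repr_sub_eq (hh : ContinuousOn h (Iic 0)) (hv : E.IsSolution h v)
    (hw : E.IsSolution h w) (k : ℕ) :
    ∃ c, ∀ t ≤ 0, E.basis.repr (E.incl (v t - w t)) k = Real.exp (-E.eigval k * t) * c := by
  refine ⟨E.basis.repr (E.incl (v 0 - w 0)) k, fun t ht => ?_⟩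
  have hv_mode := (isSolution_iff_exp_mul_sub_eq hh hv.1).1 hv k t 0 ht le_rfl
  have hw_mode := (isSolution_iff_exp_mul_sub_eq hh hw.1).1 hw k t 0 ht le_rfl
  have hcancel : Real.exp (-E.eigval k * t) * Real.exp (E.eigval k * t) = 1 := by
    rw [← Real.exp_add]; simp
  simp only [mul_zero, Real.exp_zero, one_mul] at hv_mode hw_mode
  simp only [map_sub, lp.coeFn_sub, Pi.sub_apply]
  linear_combination Real.exp (-E.eigval k * t) * (hw_mode - hv_mode) -
    (E.basis.repr (E.incl (v t)) k - E.basis.repr (E.incl (w t)) k) * hcancel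

lemma eq_zero_of_memLp_exp_mul {l c : ℝ} (hl : θ ≤ l)
    (hc : MemLp (fun t => Real.exp (-l * t) * c) 2 (expWeight θ)) : c = 0 := by
  have hconst : MemLp (fun _ => c) 2 (expWeight 0) := by
    refine memLp_expWeight_of_le (by fun_prop) hc zero_le_one fun t ht => ?_
    rw [norm_mul, Real.norm_of_nonneg (Real.exp_pos _).le, zero_mul, Real.exp_zero, one_mul,
      one_mul, ← mul_assoc, ← Real.exp_add]
    exact le_mul_of_one_le_left (norm_nonneg c) (Real.one_le_exp (by nlinarith))
  refine ((memLp_const_iff two_ne_zero ENNReal.ofNat_ne_top).1 hconst).resolve_right ?_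
  simp [expWeight]

namespace SpectralGap

variable (S : E.SpectralGap N θ d)
include S

theorem eqOn_of_isSolution (hh : ContinuousOn h (Iic 0)) (hv : E.IsSolution h v)
    (hw : E.IsSolution h w) (hv_mem : MemLp v 2 (expWeight θ)) (hw_mem : MemLp w 2 (expWeight θ))
    (hproj : (E.PN N).orthogonalProjectionOnto (v 0) = (E.PN N).orthogonalProjectionOnto (w 0)) :
    EqOn v w (Iic 0) := by
  intro t ht
  refine ext_repr E.h1Basis fun k => sub_eq_zero.1 ?_
  obtain ⟨c, hc⟩ := hv.exists_repr_sub_eq hh hw k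
  suffices hc_zero : c = 0 by
    rw [← Pi.sub_apply, ← lp.coeFn_sub, ← map_sub, h1Basis_repr, hc t ht, hc_zero, mul_zero,
      mul_zero]
  obtain hk | hk := lt_or_ge k N
  · have hzero := orthogonalProjectionOnto_PN_eq_iff.1 hproj k hk
    rw [← orthogonalProjectionOnto_PN_eq_iff.1 rfl k hk, ← sub_eq_zero, ← Pi.sub_apply,
      ← lp.coeFn_sub, ← map_sub, h1Basis_repr, hc 0 le_rfl] at hzero
    simpa [(E.sqrt_eigval_pos k).ne'] using hzero
  · have hθ : θ ≤ E.eigval k :=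
      ((le_add_of_nonneg_right S.pos.le).trans S.high).trans (E.mono hk)
    refine eq_zero_of_memLp_exp_mul hθ ?_
    exact (memLp_repr E.basis (E.memLp_incl (hv_mem.sub hw_mem)) k).ae_eq
      (ae_expWeight_of_forall hc)

variable {p : E.PN N} (hv : IntegralSol θ h p v)
include hv

lemma repr_incl_integralSol (k : ℕ) {t : ℝ} (ht : t ≤ 0) :
    E.basis.repr (E.incl (v t)) k =
      modeSol (decide (k < N)) (E.eigval k) (fun s => E.basis.repr (h s) k) t +
        Real.exp (-E.eigval k * t) * E.basis.repr (E.incl (p : E.H1)) k := by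
  have hs := (E.sqrt_eigval_pos k).ne'
  rw [hv.eq t ht, repr_incl, repr_incl, map_add, lp.coeFn_add, Pi.add_apply,
    S.repr_mild hv.memLp_rhs, repr_free, mildCoord]
  field_simp

lemma isSolution_of_integralSol (hh : ContinuousOn h (Iic 0)) : E.IsSolution h v := by
  rw [isSolution_iff_exp_mul_sub_eq hh (S.continuousOn_integralSol hv)]
  intro k s t hst ht
  have hcancel (τ : ℝ) : Real.exp (E.eigval k * τ) * Real.exp (-E.eigval k * τ) = 1 := by
    rw [← Real.exp_add]; simp
  rw [← exp_mul_modeSol_sub (S.modeGap k) (memLp_repr E.basis hv.memLp_rhs k) hst ht,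
    S.repr_incl_integralSol hv k ht, S.repr_incl_integralSol hv k (hst.trans ht)]
  linear_combination E.basis.repr (E.incl (p : E.H1)) k * (hcancel t - hcancel s)

lemma orthogonalProjectionOnto_integralSol : (E.PN N).orthogonalProjectionOnto (v 0) = p := by
  rw [orthogonalProjectionOnto_PN_eq_iff]
  intro k hk
  rw [h1Basis_repr, h1Basis_repr, S.repr_incl_integralSol hv k le_rfl]
  simp [hk, modeSol_true_zero]

omit hv in
lemma integralSol_of_isSolution (hh : ContinuousOn h (Iic 0)) (hh_mem : MemLp h 2 (expWeight θ))
    (hv_mem : MemLp v 2 (expWeight θ)) (hv : E.IsSolution h v)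
    (hp : (E.PN N).orthogonalProjectionOnto (v 0) = p) : IntegralSol θ h p v := by
  have hu : IntegralSol θ h p (fun t => E.mild N h t + free p t) := ⟨hh_mem, fun _ _ => rfl⟩
  refine ⟨hh_mem, S.eqOn_of_isSolution hh hv (S.isSolution_of_integralSol hu hh) hv_mem
    (S.memLp_integralSol hu) ?_⟩
  rw [hp, S.orthogonalProjectionOnto_integralSol hu]

end SpectralGap

end EigenSystem

/-! ### Maps with Hölder continuous derivative -/

lemma tendsto_mul_norm_sub_rpow {X : Type*} [NormedAddCommGroup X] {ε : ℝ} (hε : 0 < ε) (K : ℝ)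
    (x : X) : Tendsto (fun y => K * ‖y - x‖ ^ ε) (𝓝 x) (𝓝 0) := by
  have hcont : Continuous fun y => K * ‖y - x‖ ^ ε :=
    .mul continuous_const (.rpow_const (by fun_prop) fun _ => .inr hε.le)
  simpa [Real.zero_rpow hε.ne'] using hcont.tendsto x

section Holder

variable {X Y Z : Type*} [NormedAddCommGroup X] [NormedSpace ℝ X] [NormedAddCommGroup Y]
  [NormedSpace ℝ Y] [NormedAddCommGroup Z] [NormedSpace ℝ Z] {ε K : ℝ}

lemma hasFDerivAt_of_taylor {f : X → Y} {f' : X →L[ℝ] Y} {x : X} (hε : 0 < ε)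
    (htaylor : ∀ y, ‖f y - f x - f' (y - x)‖ ≤ K * ‖y - x‖ ^ ε * ‖y - x‖) :
    HasFDerivAt f f' x := by
  rw [hasFDerivAt_iff_isLittleO, Asymptotics.isLittleO_iff]
  intro c hc
  filter_upwards [(tendsto_mul_norm_sub_rpow hε K x).eventually_lt_const hc] with y hy
  exact (htaylor y).trans (by gcongr)

lemma isC1Holder_of_hasFDerivAt {f : X → Y} {f' : X → X →L[ℝ] Y} (hε : 0 < ε)
    (hf : ∀ x, HasFDerivAt f (f' x) x) (hholder : ∀ x y, ‖f' x - f' y‖ ≤ K * ‖x - y‖ ^ ε) :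
    IsC1Holder ε f := by
  obtain rfl : fderiv ℝ f = f' := funext fun x => (hf x).fderiv
  refine ⟨contDiff_one_iff_fderiv.2 ⟨fun x => (hf x).differentiableAt, ?_⟩, K, hholder⟩
  refine continuous_iff_continuousAt.2 fun x => tendsto_iff_norm_sub_tendsto_zero.2 ?_
  exact squeeze_zero (fun _ => norm_nonneg _) (fun y => hholder y x)
    (tendsto_mul_norm_sub_rpow hε K x)

lemma IsC1Holder.exists_holder {F : X → Y} (hF : IsC1Holder ε F) :
    ∃ K : ℝ, 0 ≤ K ∧ ∀ x y, ‖fderiv ℝ F x - fderiv ℝ F y‖ ≤ K * ‖x - y‖ ^ ε := by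
  obtain ⟨C, hC⟩ := hF.2
  exact ⟨|C|, abs_nonneg C, fun x y => (hC x y).trans (by gcongr; exact le_abs_self C)⟩

lemma norm_taylor_le {F : X → Y} (hF : Differentiable ℝ F) (hε : 0 ≤ ε) (hK : 0 ≤ K)
    (hholder : ∀ x y, ‖fderiv ℝ F x - fderiv ℝ F y‖ ≤ K * ‖x - y‖ ^ ε) (x y : X) :
    ‖F y - F x - fderiv ℝ F x (y - x)‖ ≤ K * ‖y - x‖ ^ ε * ‖y - x‖ := by
  refine (convex_segment x y).norm_image_sub_le_of_norm_fderiv_le' (𝕜 := ℝ) (fun z _ => hF z)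
    (fun z hz => (hholder z x).trans ?_) (left_mem_segment ℝ x y) (right_mem_segment ℝ x y)
  gcongr
  exact norm_sub_le_of_mem_segment hz

lemma IsC1Holder.add {f g : X → Y} (hf : IsC1Holder ε f) (hg : IsC1Holder ε g) :
    IsC1Holder ε fun x => f x + g x := by
  obtain ⟨hf_diff, C, hC⟩ := hf
  obtain ⟨hg_diff, C', hC'⟩ := hg
  refine ⟨hf_diff.add hg_diff, C + C', fun x y => ?_⟩
  have hfderiv (x : X) : fderiv ℝ (fun x => f x + g x) x = fderiv ℝ f x + fderiv ℝ g x :=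
    fderiv_fun_add (hf_diff.differentiable one_ne_zero x) (hg_diff.differentiable one_ne_zero x)
  rw [hfderiv, hfderiv, add_sub_add_comm, add_mul]
  exact norm_add_le_of_le (hC x y) (hC' x y)

lemma IsC1Holder.clm_comp {f : X → Y} (hf : IsC1Holder ε f) (T : Y →L[ℝ] Z) :
    IsC1Holder ε fun x => T (f x) := by
  obtain ⟨hf_diff, C, hC⟩ := hf
  refine ⟨T.contDiff.comp hf_diff, ‖T‖ * C, fun x y => ?_⟩
  have hfderiv (x : X) : fderiv ℝ (fun x => T (f x)) x = T.comp (fderiv ℝ f x) :=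
    (T.hasFDerivAt.comp x (hf_diff.differentiable one_ne_zero x).hasFDerivAt).fderiv
  rw [hfderiv, hfderiv, ← ContinuousLinearMap.comp_sub, mul_assoc]
  exact (ContinuousLinearMap.opNorm_comp_le _ _).trans (by gcongr; exact hC x y)

lemma le_add_mul_rpow_of_le {a b c s : ℝ} (ha : 0 ≤ a) (hb : 0 ≤ b) (hs : 0 ≤ s) (hε : 0 ≤ ε)
    (hε' : ε ≤ 1) (hca : c ≤ a * s) (hcb : c ≤ b) : c ≤ (a + b) * s ^ ε := by
  obtain hs_le | hs_ge := le_total s 1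
  · have hs_rpow : s ≤ s ^ ε := Real.self_le_rpow_of_le_one hs hs_le hε'
    nlinarith [Real.rpow_nonneg hs ε]
  · nlinarith [Real.one_le_rpow hs_ge hε]

lemma IsCb.isC1Holder {k : ℕ} {F : X → Y} (hF : IsCb k F) (hk : 2 ≤ k) (hε : 0 ≤ ε)
    (hε' : ε ≤ 1) : IsC1Holder ε F := by
  have hC2 : ContDiff ℝ 2 F := hF.1.of_le (by exact_mod_cast hk)
  obtain ⟨M, hM⟩ := hF.2 1 (by lia)
  obtain ⟨C, hC⟩ := hF.2 2 hk
  have hM_nonneg : 0 ≤ M := (norm_nonneg _).trans (hM 0)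
  have hC_nonneg : 0 ≤ C := (norm_nonneg _).trans (hC 0)
  simp only [norm_iteratedFDeriv_one] at hM
  have hbound (x : X) : ‖fderiv ℝ (fderiv ℝ F) x‖ ≤ C := by
    rw [← norm_iteratedFDeriv_one, norm_iteratedFDeriv_fderiv]
    exact hC x
  have hdiff : Differentiable ℝ (fderiv ℝ F) :=
    (hC2.fderiv_right (m := 1) (by norm_num)).differentiable one_ne_zero
  refine ⟨hC2.of_le (by norm_num), C + 2 * M, fun x y => ?_⟩
  refine le_add_mul_rpow_of_le hC_nonneg (by positivity) (norm_nonneg _) hε hε' ?_ ?_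
  · exact convex_univ.norm_image_sub_le_of_norm_fderiv_le (𝕜 := ℝ) (fun z _ => hdiff z)
      (fun z _ => hbound z) (mem_univ y) (mem_univ x)
  · rw [two_mul]
    exact norm_sub_le_of_le (hM x) (hM y)

end Holder

lemma exp_mul_norm_le_of_norm_le_rpow_mul {X Y Z : Type*} [NormedAddCommGroup X]
    [NormedAddCommGroup Y] [NormedAddCommGroup Z] {θ ε K B t : ℝ} {x : X} {y : Y} {z : Z}
    (hε : 0 ≤ ε) (hK : 0 ≤ K) (hx : Real.exp (θ * t) * ‖x‖ ≤ B) (hz : ‖z‖ ≤ K * ‖x‖ ^ ε * ‖y‖) :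
    Real.exp ((1 + ε) * θ * t) * ‖z‖ ≤ K * B ^ ε * (Real.exp (θ * t) * ‖y‖) := by
  have hexp : Real.exp ((1 + ε) * θ * t) = Real.exp (θ * t) ^ ε * Real.exp (θ * t) := by
    rw [← Real.exp_mul, ← Real.exp_add]
    congr 1
    ring
  calc Real.exp ((1 + ε) * θ * t) * ‖z‖
      ≤ Real.exp (θ * t) ^ ε * Real.exp (θ * t) * (K * ‖x‖ ^ ε * ‖y‖) := by
        rw [hexp]
        gcongr
    _ = K * (Real.exp (θ * t) * ‖x‖) ^ ε * (Real.exp (θ * t) * ‖y‖) := by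
        rw [Real.mul_rpow (Real.exp_pos _).le (norm_nonneg _)]
        ring
    _ ≤ _ := by gcongr

lemma WeightedBound.memLp_and_lpNorm_le_of_norm_le_rpow_mul {X Y Z : Type*} [NormedAddCommGroup X]
    [NormedAddCommGroup Y] [NormedAddCommGroup Z] {θ ε K B B' : ℝ} {x : ℝ → X} {y : ℝ → Y}
    {z : ℝ → Z} (hε : 0 ≤ ε) (hK : 0 ≤ K) (hx : WeightedBound θ x B) (hy : WeightedBound θ y B')
    (hz : ContinuousOn z (Iic 0)) (hle : ∀ t ≤ 0, ‖z t‖ ≤ K * ‖x t‖ ^ ε * ‖y t‖) :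
    MemLp z 2 (expWeight ((1 + ε) * θ)) ∧
      lpNorm z 2 (expWeight ((1 + ε) * θ)) ≤ K * B ^ ε * B' := by
  have hB : 0 ≤ B := lpNorm_nonneg.trans hx.lpNorm_le
  have hmeas := aestronglyMeasurable_expWeight_of_continuousOn hz ((1 + ε) * θ)
  have hexp (t : ℝ) (ht : t ≤ 0) :=
    exp_mul_norm_le_of_norm_le_rpow_mul hε hK (hx.exp_mul_norm_le t ht) (hle t ht)
  have hKB : 0 ≤ K * B ^ ε := by positivity
  refine ⟨memLp_expWeight_of_le hmeas hy.memLp hKB hexp,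
    (lpNorm_expWeight_le hmeas hy.memLp hKB hexp).trans ?_⟩
  gcongr
  exact hy.lpNorm_le

/-! ### Families of functions differentiable with respect to a parameter -/

/-- The family `V p` of functions on `ℝ₋` is differentiable in the parameter `p`, with derivative
`W p ξ` in the direction `ξ`: Taylor and Hölder estimates with exponent `ε` hold both in `L²_θ` and
in the supremum of `e^{θt} ‖·‖`. -/
structure HolderFamily {P X : Type*} [NormedAddCommGroup P] [NormedSpace ℝ P]
    [NormedAddCommGroup X] [NormedSpace ℝ X] (θ ε C : ℝ) (V : P → ℝ → X) (W : P → P → ℝ → X) :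
    Prop where
  nonneg : 0 ≤ C
  memLp : ∀ p, MemLp (V p) 2 (expWeight θ)
  memLp_deriv : ∀ p ξ, MemLp (W p ξ) 2 (expWeight θ)
  deriv_add : ∀ p ξ η, ∀ t ≤ 0, W p (ξ + η) t = W p ξ t + W p η t
  deriv_smul : ∀ p (c : ℝ) ξ, ∀ t ≤ 0, W p (c • ξ) t = c • W p ξ t
  taylor : ∀ p q, WeightedBound θ (fun t => V q t - V p t - W p (q - p) t)
    (C * ‖q - p‖ ^ ε * ‖q - p‖)
  holder : ∀ p q ξ, WeightedBound θ (fun t => W p ξ t - W q ξ t) (C * ‖p - q‖ ^ ε * ‖ξ‖)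

namespace HolderFamily

variable {P X : Type*} [NormedAddCommGroup P] [NormedSpace ℝ P] [FiniteDimensional ℝ P]
  [NormedAddCommGroup X] [NormedSpace ℝ X] {θ ε C : ℝ} {V : P → ℝ → X} {W : P → P → ℝ → X}
  (hV : HolderFamily θ ε C V W)

/-- The derivative `ξ ↦ W p ξ t` of `p ↦ V p t`. -/
def derivAt (p : P) {t : ℝ} (ht : t ≤ 0) : P →L[ℝ] X :=
  LinearMap.toContinuousLinearMap
    { toFun ξ := W p ξ t
      map_add' ξ η := hV.deriv_add p ξ η t ht
      map_smul' c ξ := hV.deriv_smul p c ξ t ht }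

/-- The derivative `ξ ↦ W p ξ` of `p ↦ V p` as a map into `L²_θ`. -/
def derivLp (p : P) : P →L[ℝ] Lp X 2 (expWeight θ) :=
  LinearMap.toContinuousLinearMap
    { toFun ξ := (hV.memLp_deriv p ξ).toLp (W p ξ)
      map_add' ξ η := by
        rw [← MemLp.toLp_add, MemLp.toLp_eq_toLp_iff]
        exact ae_expWeight_of_forall (hV.deriv_add p ξ η)
      map_smul' c ξ := by
        rw [RingHom.id_apply, ← MemLp.toLp_const_smul, MemLp.toLp_eq_toLp_iff]
        exact ae_expWeight_of_forall (hV.deriv_smul p c ξ) }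

include hV

lemma hasFDerivAt_apply (hε : 0 < ε) (p : P) {t : ℝ} (ht : t ≤ 0) :
    HasFDerivAt (fun q => V q t) (hV.derivAt p ht) p := by
  refine hasFDerivAt_of_taylor (K := (Real.exp (θ * t))⁻¹ * C) hε fun q => ?_
  rw [mul_assoc, mul_assoc, ← mul_assoc C, le_inv_mul_iff₀ (Real.exp_pos _)]
  exact (hV.taylor p q).exp_mul_norm_le t ht

lemma fderiv_apply (hε : 0 < ε) (p ξ : P) {t : ℝ} (ht : t ≤ 0) :
    fderiv ℝ (fun q => V q t) p ξ = W p ξ t := by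
  rw [(hV.hasFDerivAt_apply hε p ht).fderiv]
  rfl

lemma isC1Holder_apply (hε : 0 < ε) {t : ℝ} (ht : t ≤ 0) : IsC1Holder ε fun p => V p t := by
  have hC := hV.nonneg
  refine isC1Holder_of_hasFDerivAt (K := (Real.exp (θ * t))⁻¹ * C) hε
    (fun p => hV.hasFDerivAt_apply hε p ht) fun p q => ?_
  refine ContinuousLinearMap.opNorm_le_bound _ (by positivity) fun ξ => ?_
  rw [mul_assoc, mul_assoc, ← mul_assoc C, le_inv_mul_iff₀ (Real.exp_pos _)]
  exact (hV.holder p q ξ).exp_mul_norm_le t ht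

lemma isC1Holder_toLp (hε : 0 < ε) : IsC1Holder ε fun p => (hV.memLp p).toLp (V p) := by
  have hC := hV.nonneg
  refine isC1Holder_of_hasFDerivAt (f' := hV.derivLp) (K := C) hε
    (fun p => hasFDerivAt_of_taylor (K := C) hε fun q => ?_) fun p q => ?_
  · have hsub : (hV.memLp q).toLp (V q) - (hV.memLp p).toLp (V p) - hV.derivLp p (q - p) =
        (((hV.memLp q).sub (hV.memLp p)).sub (hV.memLp_deriv p (q - p))).toLp _ := rfl
    rw [hsub, Lp.norm_toLp]
    exact (toReal_eLpNorm (hV.taylor p q).memLp.1).trans_le (hV.taylor p q).lpNorm_le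
  · refine ContinuousLinearMap.opNorm_le_bound _ (by positivity) fun ξ => ?_
    have hsub : (hV.derivLp p - hV.derivLp q) ξ =
        ((hV.memLp_deriv p ξ).sub (hV.memLp_deriv q ξ)).toLp _ := rfl
    rw [hsub, Lp.norm_toLp]
    exact (toReal_eLpNorm (hV.holder p q ξ).memLp.1).trans_le (hV.holder p q ξ).lpNorm_le

lemma eLpNorm_taylor_le (hε : 0 < ε) (p q : P) :
    eLpNorm (fun t => V q t - V p t - fderiv ℝ (fun p => V p t) p (q - p)) 2 (expWeight θ) ≤
      ENNReal.ofReal (C * ‖q - p‖ ^ (1 + ε)) := by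
  have hae : (fun t => V q t - V p t - fderiv ℝ (fun p => V p t) p (q - p)) =ᵐ[expWeight θ]
      fun t => V q t - V p t - W p (q - p) t :=
    ae_expWeight_of_forall fun t ht => by
      simp only [hV.fderiv_apply hε p _ ht]
  rw [eLpNorm_congr_ae hae, ← ofReal_lpNorm (hV.taylor p q).memLp, add_comm 1 ε,
    Real.rpow_add_one' (norm_nonneg _) (by positivity), ← mul_assoc]
  exact ENNReal.ofReal_le_ofReal (hV.taylor p q).lpNorm_le

end HolderFamily

/-! ### The equation and its linearization -/

section Linearization

variable {X Y : Type*} [NormedAddCommGroup X] [NormedSpace ℝ X] [NormedAddCommGroup Y]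
  [NormedSpace ℝ Y] {F : X → Y}

lemma continuousOn_fderiv_apply (hF : ContDiff ℝ 1 F) {v w : ℝ → X}
    (hv : ContinuousOn v (Iic 0)) (hw : ContinuousOn w (Iic 0)) :
    ContinuousOn (fun t => fderiv ℝ F (v t) (w t)) (Iic 0) :=
  ((hF.continuous_fderiv one_ne_zero).comp_continuousOn hv).clm_apply hw

lemma LipschitzField.of_fderiv {θ : ℝ} {L : ℝ≥0} (hF : ContDiff ℝ 1 F)
    (hL : LipschitzWith L F) {v : ℝ → X} (hv : ContinuousOn v (Iic 0)) :
    LipschitzField θ L fun t x => fderiv ℝ F (v t) x :=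
  .of_clm ((hF.continuous_fderiv one_ne_zero).comp_continuousOn hv) fun _ =>
    norm_fderiv_le_of_lipschitz ℝ hL

end Linearization

namespace EigenSystem

variable {H : Type*} [NormedAddCommGroup H] [InnerProductSpace ℝ H] [CompleteSpace H]
  {A : PosSelfAdjointOp H} {E : EigenSystem A} {N : ℕ} {θ d d' ε : ℝ} {L₁ L₂ : ℝ≥0}
  {F₁ : E.H1 → H} {F₂ : E.H1 → E.H1}

/-- The nonlinearity `F₁ + F₂` of the equation, as a map from `H_0^1` to `H`. -/
def nonlin (F₁ : E.H1 → H) (F₂ : E.H1 → E.H1) (x : E.H1) : H := F₁ x + E.incl (F₂ x)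

variable (E) in
/-- The embedding of `H_0^1` into `H` as a bounded operator. -/
def inclCLM : E.H1 →L[ℝ] H := E.incl.mkContinuous _ E.norm_incl_le

lemma isC1Holder_nonlin (hF₁ : IsC1Holder ε F₁) (hF₂ : IsC1Holder ε F₂) :
    IsC1Holder ε (nonlin F₁ F₂) :=
  hF₁.add (hF₂.clm_comp E.inclCLM)

lemma contDiff_nonlin (hF₁ : ContDiff ℝ 1 F₁) (hF₂ : ContDiff ℝ 1 F₂) :
    ContDiff ℝ 1 (nonlin F₁ F₂) :=
  hF₁.add (E.inclCLM.contDiff.comp hF₂)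

lemma fderiv_nonlin_apply (hF₁ : ContDiff ℝ 1 F₁) (hF₂ : ContDiff ℝ 1 F₂) (x w : E.H1) :
    fderiv ℝ (nonlin F₁ F₂) x w = fderiv ℝ F₁ x w + E.incl (fderiv ℝ F₂ x w) :=
  congrArg (fun T : E.H1 →L[ℝ] H => T w) <|
    ((hF₁.differentiable one_ne_zero x).hasFDerivAt.add <| E.inclCLM.hasFDerivAt.comp x
      (hF₂.differentiable one_ne_zero x).hasFDerivAt).fderiv

namespace SpectralGap

variable (S : E.SpectralGap N θ d)
include S

lemma theta_pos : 0 < θ := by linarith [E.lam_nonneg N, S.low, S.pos]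

section Linear

variable (hL : √(E.eigval N) * L₁ + L₂ < d) (hF₁ : ContDiff ℝ 1 F₁) (hF₂ : ContDiff ℝ 1 F₂)
  (hL₁ : LipschitzWith L₁ F₁) (hL₂ : LipschitzWith L₂ F₂)
include hL hF₁ hF₂ hL₁ hL₂

lemma exists_weightedBound_linear :
    ∃ C : ℝ, 0 ≤ C ∧ ∀ {v z : ℝ → E.H1} {r : ℝ → H} {ξ : E.PN N}, ContinuousOn v (Iic 0) →
      MemLp r 2 (expWeight θ) →
      IntegralSol θ (fun t => fderiv ℝ (nonlin F₁ F₂) (v t) (z t) + r t) ξ z →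
      WeightedBound θ z (C * (lpNorm r 2 (expWeight θ) + ‖ξ‖)) := by
  obtain ⟨C, hC, hbound⟩ := S.exists_weightedBound hL
  refine ⟨C, hC, fun {v z r ξ} hv hr hz => ?_⟩
  have hz_mem := S.memLp_integralSol hz
  have hT₁ : LipschitzField θ L₁ fun t x => fderiv ℝ F₁ (v t) x := .of_fderiv hF₁ hL₁ hv
  have hT₂ : LipschitzField θ L₂ fun t x => fderiv ℝ F₂ (v t) x := .of_fderiv hF₂ hL₂ hv
  refine hbound (hT₁.memLp_comp hz_mem) (hT₂.memLp_comp hz_mem) hr (fun t ht => ?_) (fun t ht => ?_)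
    (hz.congr fun t _ => by simp only [fderiv_nonlin_apply hF₁ hF₂])
  · simpa only [map_zero, sub_zero] using hT₁.norm_sub_le ht (z t) 0
  · simpa only [map_zero, sub_zero] using hT₂.norm_sub_le ht (z t) 0

lemma exists_integralSol_linear {v : ℝ → E.H1} (hv : ContinuousOn v (Iic 0)) (ξ : E.PN N) :
    ∃ w, IntegralSol θ (fun t => fderiv ℝ (nonlin F₁ F₂) (v t) (w t)) ξ w := by
  obtain ⟨w, hw⟩ := S.exists_integralSol (.of_fderiv hF₁ hL₁ hv) (.of_fderiv hF₂ hL₂ hv) hL ξ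
  exact ⟨w, hw.congr fun t _ => (fderiv_nonlin_apply hF₁ hF₂ _ _).symm⟩

lemma eqOn_integralSol_linear {v w z : ℝ → E.H1} {ξ : E.PN N} (hv : ContinuousOn v (Iic 0))
    (hw : IntegralSol θ (fun t => fderiv ℝ (nonlin F₁ F₂) (v t) (w t)) ξ w)
    (hz : IntegralSol θ (fun t => fderiv ℝ (nonlin F₁ F₂) (v t) (z t)) ξ z) :
    EqOn w z (Iic 0) := by
  obtain ⟨C, -, hbound⟩ := S.exists_weightedBound_linear hL hF₁ hF₂ hL₁ hL₂
  have hsub : WeightedBound θ (fun t => w t - z t) 0 := by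
    simpa using hbound hv MemLp.zero'
      ((S.integralSol_sub hw hz).congr fun t _ => by rw [map_sub, add_zero])
  exact fun t ht => sub_eq_zero.1 (hsub.eq_zero ht)

end Linear

section Nonlinear

variable (hL : √(E.eigval N) * L₁ + L₂ < d) (hL₁ : LipschitzWith L₁ F₁) (hL₂ : LipschitzWith L₂ F₂)
include hL hL₁ hL₂

lemma exists_integralSol_nonlin (p : E.PN N) :
    ∃ v, IntegralSol θ (fun t => nonlin F₁ F₂ (v t)) p v :=
  S.exists_integralSol (.of_lipschitzWith S.theta_pos hL₁) (.of_lipschitzWith S.theta_pos hL₂) hL p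

lemma exists_weightedBound_nonlin_sub :
    ∃ C : ℝ, 0 ≤ C ∧ ∀ {p q : E.PN N} {v w : ℝ → E.H1},
      IntegralSol θ (fun t => nonlin F₁ F₂ (v t)) p v →
      IntegralSol θ (fun t => nonlin F₁ F₂ (w t)) q w →
      WeightedBound θ (fun t => v t - w t) (C * ‖p - q‖) := by
  obtain ⟨C, hC, hbound⟩ := S.exists_weightedBound hL
  refine ⟨C, hC, fun {p q v w} hv hw => ?_⟩
  have hG₁ : LipschitzField θ L₁ fun _ => F₁ := .of_lipschitzWith S.theta_pos hL₁
  have hG₂ : LipschitzField θ L₂ fun _ => F₂ := .of_lipschitzWith S.theta_pos hL₂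
  have hv_mem := S.memLp_integralSol hv
  have hw_mem := S.memLp_integralSol hw
  simpa using hbound ((hG₁.memLp_comp hv_mem).sub (hG₁.memLp_comp hw_mem))
    ((hG₂.memLp_comp hv_mem).sub (hG₂.memLp_comp hw_mem)) MemLp.zero'
    (fun t ht => hG₁.norm_sub_le ht (v t) (w t)) (fun t ht => hG₂.norm_sub_le ht (v t) (w t))
    ((S.integralSol_sub hv hw).congr fun t _ => by
      simp only [nonlin, Pi.sub_apply, map_sub, add_zero]; abel)

lemma eqOn_integralSol_nonlin {v w : ℝ → E.H1} {p : E.PN N}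
    (hv : IntegralSol θ (fun t => nonlin F₁ F₂ (v t)) p v)
    (hw : IntegralSol θ (fun t => nonlin F₁ F₂ (w t)) p w) : EqOn v w (Iic 0) := by
  obtain ⟨C, -, hbound⟩ := S.exists_weightedBound_nonlin_sub hL hL₁ hL₂
  have hsub : WeightedBound θ (fun t => v t - w t) 0 := by simpa using hbound hv hw
  exact fun t ht => sub_eq_zero.1 (hsub.eq_zero ht)

lemma isPerronMap {V : E.PN N → ℝ → E.H1}
    (hV : ∀ p, IntegralSol θ (fun t => nonlin F₁ F₂ (V p t)) p (V p)) :
    E.IsPerronMap F₁ F₂ θ N V := by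
  have hcont {v : ℝ → E.H1} (hv : ContinuousOn v (Iic 0)) :
      ContinuousOn (fun t => nonlin F₁ F₂ (v t)) (Iic 0) :=
    (hL₁.continuous.add (E.continuous_incl.comp hL₂.continuous)).comp_continuousOn hv
  have hmem {v : ℝ → E.H1} (hv : MemLp v 2 (expWeight θ)) :
      MemLp (fun t => nonlin F₁ F₂ (v t)) 2 (expWeight θ) :=
    memLp_source (.of_lipschitzWith S.theta_pos hL₁) (.of_lipschitzWith S.theta_pos hL₂) hv
  refine fun p => ⟨⟨S.memLp_integralSol (hV p), S.isSolution_of_integralSol (hV p)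
    (hcont (S.continuousOn_integralSol (hV p))),
    S.orthogonalProjectionOnto_integralSol (hV p)⟩, fun v ⟨hv, hsol, hp⟩ => ?_⟩
  exact S.eqOn_integralSol_nonlin hL hL₁ hL₂
    (S.integralSol_of_isSolution (hcont hsol.1) (hmem hv) hv hsol hp) (hV p)

end Nonlinear

section Variation

variable (hF₁ : ContDiff ℝ 1 F₁) (hF₂ : ContDiff ℝ 1 F₂) {v w : ℝ → E.H1}
  (hv : ContinuousOn v (Iic 0)) {ξ : E.PN N}
include hF₁ hF₂ hv

lemma isVariationSolution
    (hw : IntegralSol θ (fun t => fderiv ℝ (nonlin F₁ F₂) (v t) (w t)) ξ w) :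
    E.IsVariationSolution F₁ F₂ θ N v ξ w := by
  have hsol := S.isSolution_of_integralSol hw (continuousOn_fderiv_apply
    (contDiff_nonlin hF₁ hF₂) hv (S.continuousOn_integralSol hw))
  simp only [fderiv_nonlin_apply hF₁ hF₂] at hsol
  exact ⟨S.memLp_integralSol hw, hsol, S.orthogonalProjectionOnto_integralSol hw⟩

lemma integralSol_of_isVariationSolution (hL₁ : LipschitzWith L₁ F₁) (hL₂ : LipschitzWith L₂ F₂)
    (hw : E.IsVariationSolution F₁ F₂ θ N v ξ w) :
    IntegralSol θ (fun t => fderiv ℝ (nonlin F₁ F₂) (v t) (w t)) ξ w := by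
  obtain ⟨hw_mem, hsol, hξ⟩ := hw
  have hcont := continuousOn_fderiv_apply (contDiff_nonlin hF₁ hF₂) hv hsol.1
  simp only [fderiv_nonlin_apply hF₁ hF₂] at hcont ⊢
  exact S.integralSol_of_isSolution hcont
    (memLp_source (.of_fderiv hF₁ hL₁ hv) (.of_fderiv hF₂ hL₂ hv) hw_mem) hw_mem hsol hξ

end Variation

end SpectralGap

/-! ### Dependence of the solution on its initial projection -/

namespace SpectralGap

variable (S : E.SpectralGap N θ d) (S' : E.SpectralGap N ((1 + ε) * θ) d')
  (hL : √(E.eigval N) * L₁ + L₂ < d) (hL' : √(E.eigval N) * L₁ + L₂ < d') (hε : 0 < ε)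
  (hF₁ : IsC1Holder ε F₁) (hF₂ : IsC1Holder ε F₂)
  (hL₁ : LipschitzWith L₁ F₁) (hL₂ : LipschitzWith L₂ F₂)

section

include S' hL' hε hF₁ hF₂ hL₁ hL₂

lemma exists_weightedBound_of_norm_le_rpow_mul :
    ∃ C : ℝ, 0 ≤ C ∧ ∀ {v x y z : ℝ → E.H1} {r : ℝ → H} {K B B' : ℝ}, 0 ≤ K →
      ContinuousOn v (Iic 0) → ContinuousOn r (Iic 0) →
      WeightedBound θ x B → WeightedBound θ y B' →
      (∀ t ≤ 0, ‖r t‖ ≤ K * ‖x t‖ ^ ε * ‖y t‖) →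
      IntegralSol ((1 + ε) * θ) (fun t => fderiv ℝ (nonlin F₁ F₂) (v t) (z t) + r t)
        (0 : E.PN N) z →
      WeightedBound ((1 + ε) * θ) z (C * (K * B ^ ε * B')) := by
  obtain ⟨C, hC, hbound⟩ := S'.exists_weightedBound_linear hL' hF₁.1 hF₂.1 hL₁ hL₂
  refine ⟨C, hC, fun {v x y z r K B B'} hK hv hr hx hy hle hz => ?_⟩
  obtain ⟨hr_mem, hr_le⟩ :=
    WeightedBound.memLp_and_lpNorm_le_of_norm_le_rpow_mul hε.le hK hx hy hr hle
  refine (hbound hv hr_mem hz).mono ?_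
  rw [norm_zero, add_zero]
  gcongr

end

include S S' hL hL' hε hF₁ hF₂ hL₁ hL₂

lemma exists_taylor :
    ∃ C : ℝ, 0 ≤ C ∧ ∀ {p q : E.PN N} {v u w : ℝ → E.H1},
      IntegralSol θ (fun t => nonlin F₁ F₂ (v t)) p v →
      IntegralSol θ (fun t => nonlin F₁ F₂ (u t)) q u →
      IntegralSol θ (fun t => fderiv ℝ (nonlin F₁ F₂) (v t) (w t)) (q - p) w →
      WeightedBound ((1 + ε) * θ) (fun t => u t - v t - w t) (C * ‖q - p‖ ^ ε * ‖q - p‖) := by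
  have hF := isC1Holder_nonlin hF₁ hF₂
  obtain ⟨K, hK, hholder⟩ := hF.exists_holder
  obtain ⟨C₁, hC₁, hlip⟩ := S.exists_weightedBound_nonlin_sub hL hL₁ hL₂
  obtain ⟨C₂, hC₂, hrem⟩ :=
    S'.exists_weightedBound_of_norm_le_rpow_mul hL' hε hF₁ hF₂ hL₁ hL₂
  refine ⟨C₂ * (K * C₁ ^ ε * C₁), by positivity, fun {p q v u w} hv hu hw => ?_⟩
  have hθ : θ ≤ (1 + ε) * θ := by nlinarith [S.theta_pos]
  have hv_cont := S.continuousOn_integralSol hv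
  have hu_cont := S.continuousOn_integralSol hu
  have hrem_cont : ContinuousOn (fun t => nonlin F₁ F₂ (u t) - nonlin F₁ F₂ (v t) -
      fderiv ℝ (nonlin F₁ F₂) (v t) (u t - v t)) (Iic 0) :=
    ((hF.1.continuous.comp_continuousOn hu_cont).sub
      (hF.1.continuous.comp_continuousOn hv_cont)).sub
      (continuousOn_fderiv_apply hF.1 hv_cont (hu_cont.sub hv_cont))
  have hsol := (S.integralSol_sub (S.integralSol_sub hu hv) hw).mono hθ
  rw [sub_self] at hsol
  refine (hrem hK hv_cont hrem_cont (hlip hu hv) (hlip hu hv)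
    (fun t _ => norm_taylor_le (hF.1.differentiable one_ne_zero) hε.le hK hholder _ _)
    (hsol.congr fun t _ => by simp only [map_sub]; abel)).mono (le_of_eq ?_)
  rw [Real.mul_rpow hC₁ (norm_nonneg _)]
  ring

lemma exists_holder_linear :
    ∃ C : ℝ, 0 ≤ C ∧ ∀ {p q ξ : E.PN N} {v u w z : ℝ → E.H1},
      IntegralSol θ (fun t => nonlin F₁ F₂ (v t)) p v →
      IntegralSol θ (fun t => nonlin F₁ F₂ (u t)) q u →
      IntegralSol θ (fun t => fderiv ℝ (nonlin F₁ F₂) (v t) (w t)) ξ w →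
      IntegralSol θ (fun t => fderiv ℝ (nonlin F₁ F₂) (u t) (z t)) ξ z →
      WeightedBound ((1 + ε) * θ) (fun t => w t - z t) (C * ‖p - q‖ ^ ε * ‖ξ‖) := by
  have hF := isC1Holder_nonlin hF₁ hF₂
  obtain ⟨K, hK, hholder⟩ := hF.exists_holder
  obtain ⟨C₁, hC₁, hlip⟩ := S.exists_weightedBound_nonlin_sub hL hL₁ hL₂
  obtain ⟨C₂, hC₂, hrem⟩ :=
    S'.exists_weightedBound_of_norm_le_rpow_mul hL' hε hF₁ hF₂ hL₁ hL₂
  obtain ⟨C₃, hC₃, hlin⟩ := S.exists_weightedBound_linear hL hF₁.1 hF₂.1 hL₁ hL₂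
  refine ⟨C₂ * (K * C₁ ^ ε * C₃), by positivity, fun {p q ξ v u w z} hv hu hw hz => ?_⟩
  have hθ : θ ≤ (1 + ε) * θ := by nlinarith [S.theta_pos]
  have hv_cont := S.continuousOn_integralSol hv
  have hu_cont := S.continuousOn_integralSol hu
  have hz_cont := S.continuousOn_integralSol hz
  have hz_bound : WeightedBound θ z (C₃ * ‖ξ‖) := by
    simpa using hlin hu_cont MemLp.zero' (hz.congr fun t _ => (add_zero _).symm)
  have hsol := (S.integralSol_sub hw hz).mono hθ
  rw [sub_self] at hsol
  refine (hrem (r := fun t => (fderiv ℝ (nonlin F₁ F₂) (v t) - fderiv ℝ (nonlin F₁ F₂) (u t)) (z t))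
    hK hv_cont ?_ (hlip hv hu) hz_bound
    (fun t _ => ContinuousLinearMap.le_of_opNorm_le _ (hholder _ _) _)
    (hsol.congr fun t _ => ?_)).mono (le_of_eq ?_)
  · exact (continuousOn_fderiv_apply hF.1 hv_cont hz_cont).sub
      (continuousOn_fderiv_apply hF.1 hu_cont hz_cont)
  · simp only [map_sub, sub_apply]
    abel
  · rw [Real.mul_rpow hC₁ (norm_nonneg _)]
    ring

theorem exists_holderFamily :
    ∃ (C : ℝ) (V : E.PN N → ℝ → E.H1) (W : E.PN N → E.PN N → ℝ → E.H1),
      (∀ p, IntegralSol θ (fun t => nonlin F₁ F₂ (V p t)) p (V p)) ∧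
      (∀ p ξ, IntegralSol θ (fun t => fderiv ℝ (nonlin F₁ F₂) (V p t) (W p ξ t)) ξ (W p ξ)) ∧
      HolderFamily ((1 + ε) * θ) ε C V W := by
  choose V hV using S.exists_integralSol_nonlin hL hL₁ hL₂
  have hV_cont (p) := S.continuousOn_integralSol (hV p)
  choose W hW using fun p => S.exists_integralSol_linear hL hF₁.1 hF₂.1 hL₁ hL₂ (hV_cont p)
  obtain ⟨C₁, hC₁, htaylor⟩ := S.exists_taylor S' hL hL' hε hF₁ hF₂ hL₁ hL₂
  obtain ⟨C₂, -, hholder⟩ := S.exists_holder_linear S' hL hL' hε hF₁ hF₂ hL₁ hL₂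
  have hθ : θ ≤ (1 + ε) * θ := by nlinarith [S.theta_pos]
  have hW_eq {p ξ} {w : ℝ → E.H1} :=
    S.eqOn_integralSol_linear (w := W p ξ) (z := w) hL hF₁.1 hF₂.1 hL₁ hL₂ (hV_cont p) (hW p ξ)
  refine ⟨max C₁ C₂, V, W, hV, hW, hC₁.trans (le_max_left _ _),
    fun p => memLp_expWeight_mono hθ (S.memLp_integralSol (hV p)),
    fun p ξ => memLp_expWeight_mono hθ (S.memLp_integralSol (hW p ξ)),
    fun p ξ η => hW_eq ((S.integralSol_add (hW p ξ) (hW p η)).congr fun t _ => by rw [map_add]),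
    fun p c ξ => hW_eq ((S.integralSol_smul (hW p ξ) c).congr fun t _ => by rw [map_smul]),
    fun p q => (htaylor (hV p) (hV q) (hW p (q - p))).mono ?_,
    fun p q ξ => (hholder (hV p) (hV q) (hW p ξ) (hW q ξ)).mono ?_⟩
  · gcongr
    exact le_max_left _ _
  · gcongr
    exact le_max_right _ _

end SpectralGap

end EigenSystem

namespace EigenSystem

variable {H : Type*} [NormedAddCommGroup H] [InnerProductSpace ℝ H] [CompleteSpace H]
  {A : PosSelfAdjointOp H} {E : EigenSystem A}

section Graph

variable {N : ℕ} {V : E.PN N → ℝ → E.H1}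

lemma range_eq_range_add_graphMap
    (hV : ∀ p, (E.PN N).orthogonalProjectionOnto (V p 0) = p) :
    (Set.range fun p => V p 0) = Set.range fun p : E.PN N => (p : E.H1) + graphMap V p := by
  congr 1
  ext1 p
  have hsum := (E.PN N).starProjection_add_starProjection_orthogonal (V p 0)
  rw [Submodule.starProjection_apply, Submodule.starProjection_apply, hV p] at hsum
  exact hsum.symm

lemma fderiv_graphMap_apply {p : E.PN N} (hV : DifferentiableAt ℝ (fun q => V q 0) p)
    (ξ : E.PN N) :
    fderiv ℝ (graphMap V) p ξ = (E.PN N)ᗮ.orthogonalProjectionOnto (derivV V p ξ 0) :=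
  congrArg (fun T : E.PN N →L[ℝ] (E.PN N)ᗮ => T ξ)
    ((E.PN N)ᗮ.orthogonalProjectionOnto.hasFDerivAt.comp p hV.hasFDerivAt).fderiv

end Graph

/-! ### The spectral gap condition -/

lemma SpectralGap.exists_of_lt {N : ℕ} {θ κ : ℝ} (hκ : 0 ≤ κ) (hlow : E.lam N + κ < θ)
    (hhigh : θ + κ < E.lam (N + 1)) : ∃ d, E.SpectralGap N θ d ∧ κ < d := by
  have hκd : κ < min (θ - E.lam N) (E.lam (N + 1) - θ) := lt_min (by linarith) (by linarith)
  exact ⟨_, ⟨hκ.trans_lt hκd, by linarith [min_le_left (θ - E.lam N) (E.lam (N + 1) - θ)],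
    by linarith [min_le_right (θ - E.lam N) (E.lam (N + 1) - θ)]⟩, hκd⟩

section Gap

variable {n : ℕ} (hn : 1 ≤ n) {N : ℕ → ℕ} {L₁ L₂ : ℝ≥0}

lemma gapGamma_pos (hgap : ∀ i ∈ Finset.Icc 1 n, 0 < E.gapExcess N L₁ L₂ i) :
    0 < E.gapGamma hn N L₁ L₂ := by
  refine (Finset.lt_inf'_iff _).2 fun i hi => ?_
  have hi_pos := hgap i hi
  positivity

variable (hγ : 0 < E.gapGamma hn N L₁ L₂)
include hγ

lemma lam_add_lt_theta (i : ℕ) :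
    E.lam (N i) + (√(E.lam (N i + 1)) * L₁ + L₂) < E.theta hn N L₁ L₂ i := by
  rw [theta]
  linarith

lemma theta_pos (i : ℕ) : 0 < E.theta hn N L₁ L₂ i :=
  (add_nonneg (E.lam_nonneg (N i)) (by positivity)).trans_lt (lam_add_lt_theta hn hγ i)

lemma theta_add_gapGamma_add_le {i : ℕ} (hi : i ∈ Finset.Icc 1 n) :
    E.theta hn N L₁ L₂ i + E.gapGamma hn N L₁ L₂ + (√(E.lam (N i + 1)) * L₁ + L₂) ≤
      E.lam (N i + 1) := by
  have hmin : E.gapGamma hn N L₁ L₂ ≤ E.gapExcess N L₁ L₂ i / ((i : ℝ) + 1) :=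
    Finset.inf'_le _ hi
  rw [le_div_iff₀ (by positivity), gapExcess] at hmin
  have hi_sub : (0 : ℝ) ≤ i - 1 := sub_nonneg.2 (by exact_mod_cast (Finset.mem_Icc.1 hi).1)
  have hlam : 0 ≤ ((i : ℝ) - 1) * E.lam (N (i - 1)) := mul_nonneg hi_sub (E.lam_nonneg _)
  have hκ : 0 ≤ √(E.lam (N i + 1)) * L₁ + L₂ := by positivity
  have hextra : 0 ≤ ((i : ℝ) - 1) *
      (E.gapGamma hn N L₁ L₂ + (√(E.lam (N i + 1)) * L₁ + L₂)) :=
    mul_nonneg hi_sub (add_nonneg hγ.le hκ)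
  rw [theta]
  linarith

theorem exists_forall_mul_theta_add_lt :
    ∃ ε₀ : ℝ, 0 < ε₀ ∧ ε₀ ≤ 1 ∧ ∀ ε < ε₀, ∀ i ∈ Finset.Icc 1 n,
      (1 + ε) * E.theta hn N L₁ L₂ i + (√(E.lam (N i + 1)) * L₁ + L₂) < E.lam (N i + 1) := by
  obtain ⟨j, -, hj⟩ := (Finset.Icc 1 n).exists_max_image (E.theta hn N L₁ L₂)
    (Finset.nonempty_Icc.2 hn)
  have hθ := theta_pos hn hγ j
  refine ⟨min 1 (E.gapGamma hn N L₁ L₂ / E.theta hn N L₁ L₂ j), by positivity, min_le_left _ _,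
    fun ε hε i hi => ?_⟩
  have hε_mul : ε * E.theta hn N L₁ L₂ i < E.gapGamma hn N L₁ L₂ :=
    calc ε * E.theta hn N L₁ L₂ i
        < E.gapGamma hn N L₁ L₂ / E.theta hn N L₁ L₂ j * E.theta hn N L₁ L₂ i :=
          mul_lt_mul_of_pos_right (hε.trans_le (min_le_right _ _)) (theta_pos hn hγ i)
      _ ≤ E.gapGamma hn N L₁ L₂ / E.theta hn N L₁ L₂ j * E.theta hn N L₁ L₂ j := by
          gcongr
          exact hj i hi
      _ = E.gapGamma hn N L₁ L₂ := div_mul_cancel₀ _ hθ.ne'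
  linarith [theta_add_gapGamma_add_le hn hγ hi]

end Gap

end EigenSystem

end InertialManifold

end

theorem proposition4p2_general {H : Type*} [NormedAddCommGroup H] [InnerProductSpace ℝ H]
    [CompleteSpace H] {A : PosSelfAdjointOp H} (E : EigenSystem A) {N : ℕ} {L₁ L₂ : ℝ≥0} {θ ε : ℝ}
    (hε : 0 < ε) (hlow : E.lam N + (√(E.lam (N + 1)) * L₁ + L₂) < θ)
    (hhigh : (1 + ε) * θ + (√(E.lam (N + 1)) * L₁ + L₂) < E.lam (N + 1))
    {F₁ : E.H1 → H} {F₂ : E.H1 → E.H1} (hF₁ : IsC1Holder ε F₁) (hF₂ : IsC1Holder ε F₂)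
    (hL₁ : LipschitzWith L₁ F₁) (hL₂ : LipschitzWith L₂ F₂) :
    ∃ V : E.PN N → ℝ → E.H1,
      E.IsPerronMap F₁ F₂ θ N V ∧
      (∀ t ≤ 0, IsC1Holder ε fun p => V p t) ∧
      (∃ hV : ∀ p, MemLp (V p) 2 (expWeight ((1 + ε) * θ)),
        IsC1Holder ε fun p => (hV p).toLp (V p)) ∧
      (Set.range fun p => V p 0) =
        (Set.range fun p : E.PN N => (p : E.H1) + EigenSystem.graphMap V p) ∧
      IsC1Holder ε (EigenSystem.graphMap V) ∧
      (∀ p ξ : E.PN N,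
        E.IsVariationSolution F₁ F₂ θ N (V p) ξ (EigenSystem.derivV V p ξ) ∧
        (∀ w, E.IsVariationSolution F₁ F₂ θ N (V p) ξ w →
          Set.EqOn w (EigenSystem.derivV V p ξ) (Set.Iic 0)) ∧
        fderiv ℝ (EigenSystem.graphMap V) p ξ =
          (E.PN N)ᗮ.orthogonalProjectionOnto (EigenSystem.derivV V p ξ 0)) ∧
      ∃ C : ℝ, ∀ p₁ p₂ : E.PN N,
        eLpNorm (fun t => V p₂ t - V p₁ t - EigenSystem.derivV V p₁ (p₂ - p₁) t) 2
            (expWeight ((1 + ε) * θ)) ≤ ENNReal.ofReal (C * ‖p₂ - p₁‖ ^ (1 + ε)) := by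
  have hκ : 0 ≤ √(E.lam (N + 1)) * L₁ + L₂ := by positivity
  have hθ : θ < (1 + ε) * θ :=
    lt_mul_of_one_lt_left (by linarith [E.lam_nonneg N]) (by linarith)
  obtain ⟨d, S, hd⟩ := EigenSystem.SpectralGap.exists_of_lt hκ hlow (by linarith)
  obtain ⟨d', S', hd'⟩ := EigenSystem.SpectralGap.exists_of_lt hκ (hlow.trans hθ) hhigh
  obtain ⟨C, V, W, hV, hW, hfamily⟩ := S.exists_holderFamily S' hd hd' hε hF₁ hF₂ hL₁ hL₂
  have hV_cont (p) := S.continuousOn_integralSol (hV p)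
  have hC1 := hfamily.isC1Holder_apply hε (le_refl 0)
  have hderiv (p ξ) : EqOn (W p ξ) (EigenSystem.derivV V p ξ) (Iic 0) := fun t ht =>
    (hfamily.fderiv_apply hε p ξ ht).symm
  have hvar (p ξ) := ((hW p ξ).congr fun t ht => by rw [hderiv p ξ ht]).congr_sol (hderiv p ξ)
  refine ⟨V, S.isPerronMap hd hL₁ hL₂ hV, fun t => hfamily.isC1Holder_apply hε,
    ⟨hfamily.memLp, hfamily.isC1Holder_toLp hε⟩,
    EigenSystem.range_eq_range_add_graphMap fun p => S.orthogonalProjectionOnto_integralSol (hV p),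
    hC1.clm_comp _, fun p ξ => ⟨S.isVariationSolution hF₁.1 hF₂.1 (hV_cont p) (hvar p ξ),
      fun w hw => ?_, EigenSystem.fderiv_graphMap_apply (hC1.1.differentiable one_ne_zero p) ξ⟩,
    C, hfamily.eLpNorm_taylor_le hε⟩
  exact S.eqOn_integralSol_linear hd hF₁.1 hF₂.1 hL₁ hL₂ (hV_cont p)
    (S.integralSol_of_isVariationSolution hF₁.1 hF₂.1 (hV_cont p) hL₁ hL₂ hw) (hvar p ξ)

theorem proposition4p2 {H : Type*} [NormedAddCommGroup H] [InnerProductSpace ℝ H]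
    [CompleteSpace H] (A : PosSelfAdjointOp H) (E : EigenSystem A)
    (n : ℕ) (hn : 1 ≤ n) (N : ℕ → ℕ) (hN0 : N 0 = 0) (hN : ∀ i ∈ Finset.Icc 1 n, 1 ≤ N i)
    (L₁ L₂ : ℝ≥0)
    (hgap : ∀ i ∈ Finset.Icc 1 n,
      E.lam (N i + 1) - E.lam (N i) >
        ((i : ℝ) - 1) * E.lam (N (i - 1)) + √(E.lam (N i + 1)) * ((i : ℝ) + 1) * L₁
          + ((i : ℝ) + 1) * L₂) :
    ∃ ε₀ : ℝ, 0 < ε₀ ∧ ε₀ ≤ 1 ∧ ∀ ε : ℝ, 0 < ε → ε < ε₀ →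
      ∀ (F₁ : E.H1 → H) (F₂ : E.H1 → E.H1),
        IsCb (n + 1) F₁ → IsCb (n + 1) F₂ → LipschitzWith L₁ F₁ → LipschitzWith L₂ F₂ →
        ∀ i ∈ Finset.Icc 1 n, ∃ V : E.PN (N i) → ℝ → E.H1,
          E.IsPerronMap F₁ F₂ (E.theta hn N L₁ L₂ i) (N i) V ∧
          -- `V` is `C^{1,ε}`: for each fixed time, and with values in the weighted space
          (∀ t ≤ 0, IsC1Holder ε fun p => V p t) ∧
          (∃ hV : ∀ p, MemLp (V p) 2 (expWeight ((1 + ε) * E.theta hn N L₁ L₂ i)),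
            IsC1Holder ε fun p => (hV p).toLp (V p)) ∧
          -- the manifold formed by the values `V(p, 0)` is the graph of the `C^{1,ε}` map `M`
          (Set.range fun p => V p 0) =
            (Set.range fun p : E.PN (N i) => (p : E.H1) + EigenSystem.graphMap V p) ∧
          IsC1Holder ε (EigenSystem.graphMap V) ∧
          -- the derivative and the equation of variations
          (∀ p ξ : E.PN (N i),
            E.IsVariationSolution F₁ F₂ (E.theta hn N L₁ L₂ i) (N i) (V p) ξ
              (EigenSystem.derivV V p ξ) ∧
            (∀ w, E.IsVariationSolution F₁ F₂ (E.theta hn N L₁ L₂ i) (N i) (V p) ξ w →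
              Set.EqOn w (EigenSystem.derivV V p ξ) (Set.Iic 0)) ∧
            fderiv ℝ (EigenSystem.graphMap V) p ξ =
              (E.PN (N i))ᗮ.orthogonalProjectionOnto (EigenSystem.derivV V p ξ 0)) ∧
          -- the Taylor estimate
          ∃ C : ℝ, ∀ p₁ p₂ : E.PN (N i),
            eLpNorm (fun t => V p₂ t - V p₁ t - EigenSystem.derivV V p₁ (p₂ - p₁) t) 2
                (expWeight ((1 + ε) * E.theta hn N L₁ L₂ i)) ≤
              ENNReal.ofReal (C * ‖p₂ - p₁‖ ^ (1 + ε)) := by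
  have hγ : 0 < E.gapGamma hn N L₁ L₂ := EigenSystem.gapGamma_pos hn fun i hi => by
    rw [EigenSystem.gapExcess]
    linarith [hgap i hi]
  obtain ⟨ε₀, hε₀, hε₀_le, hhigh⟩ := EigenSystem.exists_forall_mul_theta_add_lt hn hγ
  refine ⟨ε₀, hε₀, hε₀_le, fun ε hε hε_lt F₁ F₂ hF₁ hF₂ hL₁ hL₂ i hi => ?_⟩
  have hε_le : ε ≤ 1 := hε_lt.le.trans hε₀_le
  exact proposition4p2_general E hε (EigenSystem.lam_add_lt_theta hn hγ i) (hhigh ε hε_lt i hi)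
    (hF₁.isC1Holder (by lia) hε.le hε_le) (hF₂.isC1Holder (by lia) hε.le hε_le) hL₁ hL₂
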